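/- Let $d$ be the space dimension and let $\varphi:\mathbb R^d\to\mathbb R$ be $K$-Lipschitz and $\lambda$-concave for some $\lambda\ge 0$, i.e. $y\mapsto\varphi(y)-\frac{\lambda}{2}|y|^2$ is concave. For $\varepsilon,t>0$ let $$u^\varepsilon_t(x)=-\varepsilon\log\left(\frac{1}{(2\pi\varepsilon t)^{d/2}}\int_{\mathbb R^d}\exp\left(-\frac{|x-y|^2}{2\varepsilon t}-\frac{\varphi(y)}{\varepsilon}\right)dy\right),$$ and let $X^\varepsilon$ be the flow of $\nabla u^\varepsilon$: for every $y\in\mathbb R^d$, $t\mapsto X^\varepsilon(y,t)$ is continuous on $[0,\infty)$, $X^\varepsilon(y,0)=y$, and $\partial_tX^\varepsilon(y,t)=\nabla u^\varepsilon_t(X^\varepsilon(y,t))$ for $t>0$. Then such flows exist and the limit $X_t(y)=\lim_{\varepsilon\to0^+}X^\varepsilon(y,t)$ exists for all $y\in\mathbb R^d$ and $t\ge0$. For every $t\ge0$ let $\rho_t=(X_t)_\sharp\mathcal L$ be the pushforward of Lebesgue measure $\mathcal L$ on $\mathbb R^d$, and let $$\mathcal S_t=X_t\bigl(\{y\in\mathbb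 R^d:\nabla X_t(y)\text{ exists and is singular}\}\bigr).$$ Then $\mathcal S_t$ has Lebesgue measure zero, and the Lebesgue decomposition $\rho_t=\rho_t^{\rm ac}+\rho_t^{\rm sg}$, with $\rho_t^{\rm ac}\ll\mathcal L$ and $\rho_t^{\rm sg}\perp\mathcal L$, is given by $$\rho_t^{\rm ac}=\rho_t\llcorner(\mathbb R^d\setminus\mathcal S_t),\qquad \rho_t^{\rm sg}=\rho_t\llcorner\mathcal S_t,$$ where $(\mu\llcorner A)(B)=\mu(A\cap B)$. -/

import Mathlib

open MeasureTheory Filter Topology Set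
open scoped NNReal

noncomputable section

namespace Adhesion

/-- The Cole-Hopf potential
`u^ε_t(x) = -ε log ((2πεt)^{-d/2} ∫ exp (-|x-y|²/(2εt) - φ(y)/ε) dy)`,
meant for `ε > 0` and `t > 0`. -/
def viscousPotential {d : ℕ} (φ : EuclideanSpace ℝ (Fin d) → ℝ) (ε t : ℝ)
    (x : EuclideanSpace ℝ (Fin d)) : ℝ :=
  -ε * Real.log (1 / (2 * Real.pi * ε * t) ^ ((d : ℝ) / 2) *
    ∫ y : EuclideanSpace ℝ (Fin d),
      Real.exp (-(‖x - y‖ ^ 2 / (2 * ε * t)) - φ y / ε))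

/-- `X y t` is the flow of the velocity field `∇u^ε` on `[0, ∞)`: every path is continuous up to
time `0`, starts at `y`, and solves `∂_t X = ∇u^ε_t(X)` for `t > 0`. -/
structure IsViscousFlow {d : ℕ} (φ : EuclideanSpace ℝ (Fin d) → ℝ) (ε : ℝ)
    (X : EuclideanSpace ℝ (Fin d) → ℝ → EuclideanSpace ℝ (Fin d)) : Prop where
  initial : ∀ y, X y 0 = y
  continuousOn : ∀ y, ContinuousOn (X y) (Ici 0)
  hasDerivAt : ∀ y t, 0 < t →
    HasDerivAt (X y) (gradient (viscousPotential φ ε t) (X y t)) t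

/-- `X` is the zero-viscosity limit `X(y,t) = lim_{ε → 0+} X^ε(y,t)`, `t ≥ 0`, of the flows of
`∇u^ε`. -/
def IsLagrangianFlow {d : ℕ} (φ : EuclideanSpace ℝ (Fin d) → ℝ)
    (X : EuclideanSpace ℝ (Fin d) → ℝ → EuclideanSpace ℝ (Fin d)) : Prop :=
  ∃ Xε : ℝ → EuclideanSpace ℝ (Fin d) → ℝ → EuclideanSpace ℝ (Fin d),
    (∀ ε, 0 < ε → IsViscousFlow φ ε (Xε ε)) ∧
    ∀ y t, 0 ≤ t → Tendsto (fun ε => Xε ε y t) (𝓝[>] 0) (𝓝 (X y t))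

/-- The mass measure `ρ_t = (X_t)_♯ L`. -/
def massMeasure {d : ℕ} (X : EuclideanSpace ℝ (Fin d) → ℝ → EuclideanSpace ℝ (Fin d)) (t : ℝ) :
    Measure (EuclideanSpace ℝ (Fin d)) :=
  Measure.map (fun y => X y t) volume

/-- The points `y` at which `∇X_t(y)` exists and is singular. -/
def singularPoints {d : ℕ} (X : EuclideanSpace ℝ (Fin d) → ℝ → EuclideanSpace ℝ (Fin d)) (t : ℝ) :
    Set (EuclideanSpace ℝ (Fin d)) :=
  {y | DifferentiableAt ℝ (fun z => X z t) y ∧ (fderiv ℝ (fun z => X z t) y).det = 0}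

/-- The image `X_t({y : ∇X_t(y) exists and is singular})`. -/
def singularImage {d : ℕ} (X : EuclideanSpace ℝ (Fin d) → ℝ → EuclideanSpace ℝ (Fin d)) (t : ℝ) :
    Set (EuclideanSpace ℝ (Fin d)) :=
  (fun y => X y t) '' singularPoints X t

/-- `μ = μac + μsg` is the Lebesgue decomposition of `μ` with respect to `ν`. -/
structure IsLebesgueDecomposition {α : Type*} [MeasurableSpace α] (μ ν μac μsg : Measure α) :
    Prop where
  eq_add : μ = μac + μsg
  absolutelyContinuous : μac ≪ ν
  mutuallySingular : μsg ⟂ₘ ν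

end Adhesion

end

/-!
The Cole-Hopf potential is a log-partition function of a Gibbs measure, so by Hölder's inequality it
inherits the `λ`-concavity of `φ`. Hence `∇u^ε_t` is one-sided Lipschitz with constant `λ`, and
Grönwall's inequality makes the flow of `∇u^ε` exist and be `e^{λt}`-Lipschitz in the initial point.
Evaluating the partition function by Laplace's method shows that `u^ε` lies within
`O(ε log (1/ε))` of the Hopf-Lax function. One-sided monotonicity survives the comparison of two
`λ`-concave functions at uniform distance `η`, at the price of an error `2η`, so that the flows are
Cauchy as `ε → 0`; their limit `X_t` is again `e^{λt}`-Lipschitz.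

For a Lipschitz map `f` of `ℝ^d`, the critical values form a null set by Sard's lemma, while by
Rademacher's theorem and local linearization the preimage of a null set meets the non-critical
points only in a null set. Therefore `f_♯ L` is absolutely continuous off the image of the critical
set, and restricting it to and off this image is its Lebesgue decomposition.
-/

namespace Adhesion

section Decomposition

section InnerRegular

variable {α : Type*} [TopologicalSpace α] [T2Space α] [MeasurableSpace α]
  [OpensMeasurableSpace α]

theorem measurableSet_of_isSigmaCompact {s : Set α} (hs : IsSigmaCompact s) : MeasurableSet s := by
  obtain ⟨K, hK, rfl⟩ := hs
  exact MeasurableSet.iUnion fun n => (hK n).measurableSet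

theorem exists_isSigmaCompact_subset_measure_sdiff_eq_zero (μ : Measure α) [SigmaFinite μ]
    [μ.InnerRegularCompactLTTop] {s : Set α} (hs : MeasurableSet s) :
    ∃ t ⊆ s, IsSigmaCompact t ∧ μ (s \ t) = 0 := by
  have hK : ∀ n m : ℕ, ∃ K ⊆ s ∩ spanningSets μ n, IsCompact K ∧
      μ ((s ∩ spanningSets μ n) \ K) < (m + 1 : ENNReal)⁻¹ := fun n m =>
    (hs.inter (measurableSet_spanningSets μ n)).exists_isCompact_sdiff_lt
      (measure_ne_top_of_subset inter_subset_right (measure_spanningSets_lt_top μ n).ne)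
      (ENNReal.inv_ne_zero.2 (by finiteness))
  choose K hKs hKc hKμ using hK
  refine ⟨⋃ n, ⋃ m, K n m, iUnion₂_subset fun n m => (hKs n m).trans inter_subset_left,
    isSigmaCompact_iUnion _ fun n => isSigmaCompact_iUnion_of_isCompact _ (hKc n), ?_⟩
  have hcover : s \ ⋃ n, ⋃ m, K n m ⊆ ⋃ n, (s ∩ spanningSets μ n) \ ⋃ m, K n m := by
    rintro x ⟨hxs, hxK⟩
    obtain ⟨n, hn⟩ := mem_iUnion.1 (iUnion_spanningSets μ ▸ mem_univ x)
    exact mem_iUnion.2 ⟨n, ⟨hxs, hn⟩, fun hx => hxK (mem_iUnion.2 ⟨n, hx⟩)⟩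
  refine measure_mono_null hcover (measure_iUnion_null fun n => ?_)
  have hlim : Tendsto (fun m : ℕ => (m + 1 : ENNReal)⁻¹) atTop (𝓝 0) := by
    simpa using (tendsto_add_atTop_iff_nat 1).2 ENNReal.tendsto_inv_nat_nhds_zero
  exact nonpos_iff_eq_zero.1 (ge_of_tendsto' hlim fun m =>
    (measure_mono (sdiff_subset_sdiff_right (subset_iUnion (K n) m))).trans (hKμ n m).le)

end InnerRegular

section LebesgueDecomposition

variable {α : Type*} [MeasurableSpace α] {ρ ν ρac ρsg : Measure α}

theorem IsLebesgueDecomposition.withDensity_rnDeriv_eq [SFinite ρ] [SigmaFinite ν] [SFinite ρac]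
    (h : IsLebesgueDecomposition ρ ν ρac ρsg) : ν.withDensity (ρ.rnDeriv ν) = ρac := by
  have hac := Measure.withDensity_rnDeriv_eq ρac ν h.absolutelyContinuous
  rw [← Measure.eq_withDensity_rnDeriv (Measure.measurable_rnDeriv ρac ν) h.mutuallySingular
    (by rw [hac, add_comm, h.eq_add]), hac]

theorem IsLebesgueDecomposition.singularPart_eq [SigmaFinite ν] [SFinite ρac]
    (h : IsLebesgueDecomposition ρ ν ρac ρsg) : ρ.singularPart ν = ρsg :=
  (Measure.eq_singularPart (Measure.measurable_rnDeriv ρac ν) h.mutuallySingular (by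
    rw [Measure.withDensity_rnDeriv_eq ρac ν h.absolutelyContinuous, add_comm, h.eq_add])).symm

theorem isLebesgueDecomposition_restrict {s t : Set α} (ht : MeasurableSet t) (hts : t ⊆ s)
    (hs : ν s = 0) (hac : ρ.restrict tᶜ ≪ ν) :
    IsLebesgueDecomposition ρ ν (ρ.restrict sᶜ) (ρ.restrict s) := by
  have hst : ρ (s \ t) = 0 := by
    have := hac hs
    rwa [Measure.restrict_apply' ht.compl, ← sdiff_eq] at this
  have hae : s =ᵐ[ρ] t := (ae_le_set.2 hst).antisymm hts.eventuallyLE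
  obtain ⟨N, hsN, hN, hN0⟩ := exists_measurable_superset_of_null hs
  refine ⟨?_, (Measure.restrict_mono (compl_subset_compl.2 hts) le_rfl).absolutelyContinuous.trans
    hac, Nᶜ, hN.compl, ?_, by rwa [compl_compl]⟩
  · rw [Measure.restrict_congr_set hae, Measure.restrict_congr_set hae.compl,
      Measure.restrict_compl_add_restrict ht]
  · rw [Measure.restrict_apply hN.compl,
      (disjoint_compl_left.mono_right hsN).inter_eq, measure_empty]

end LebesgueDecomposition

section AreaFormula

variable {E : Type*} [NormedAddCommGroup E] [NormedSpace ℝ E]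

/-- The critical set of `f : E → E`: the points at which `f` is differentiable with a singular
derivative. It is the set whose image carries the singular part of the pushforward of Lebesgue
measure by `f`; points where `f` fails to be differentiable are excluded. -/
def criticalSet (f : E → E) : Set E :=
  {x | DifferentiableAt ℝ f x ∧ (fderiv ℝ f x).det = 0}

variable [FiniteDimensional ℝ E] [MeasurableSpace E] [BorelSpace E]

theorem measurableSet_criticalSet (f : E → E) : MeasurableSet (criticalSet f) :=
  (measurableSet_of_differentiableAt ℝ f).inter
    ((ContinuousLinearMap.continuous_det.measurable.comp (measurable_fderiv ℝ f))
      (measurableSet_singleton 0))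

variable (μ : Measure E) [μ.IsAddHaarMeasure] {f : E → E} {s : Set E}

theorem addHaar_image_criticalSet (f : E → E) : μ (f '' criticalSet f) = 0 :=
  addHaar_image_eq_zero_of_det_fderivWithin_eq_zero μ
    (fun _ hx => hx.1.hasFDerivAt.hasFDerivWithinAt) fun _ hx => hx.2

theorem exists_pos_forall_approximatesLinearOn_addHaar_eq_zero {A : E →L[ℝ] E} (hA : A.det ≠ 0) :
    ∃ δ : ℝ≥0, 0 < δ ∧ ∀ (f : E → E) (t : Set E), ApproximatesLinearOn f A t δ →
      μ (f '' t) = 0 → μ t = 0 := by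
  have hpos : 0 < |A.det| := abs_pos.2 hA
  have hlt : ((|A.det| / 2).toNNReal : ENNReal) < ENNReal.ofReal |A.det| :=
    ENNReal.ofReal_lt_ofReal_iff_of_nonneg (by positivity) |>.2 (half_lt_self hpos)
  obtain ⟨δ, hδ, hδ0⟩ :=
    ((mul_le_addHaar_image_of_lt_det μ A hlt).and self_mem_nhdsWithin).exists
  refine ⟨δ, hδ0, fun f t hf h0 => ?_⟩
  have hle := hδ t f hf
  rw [h0, nonpos_iff_eq_zero, mul_eq_zero] at hle
  exact hle.resolve_left (by simpa using hA)

theorem addHaar_eq_zero_of_addHaar_image_eq_zero {f' : E → E →L[ℝ] E}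
    (hf' : ∀ x ∈ s, HasFDerivWithinAt f (f' x) s x) (hdet : ∀ x ∈ s, (f' x).det ≠ 0)
    (hs : μ (f '' s) = 0) : μ s = 0 := by
  rcases s.eq_empty_or_nonempty with rfl | hne
  · exact measure_empty
  have hδ : ∀ A : E →L[ℝ] E, ∃ δ : ℝ≥0, δ ≠ 0 ∧ (A.det ≠ 0 →
      ∀ t, ApproximatesLinearOn f A t δ → μ (f '' t) = 0 → μ t = 0) := fun A => by
    by_cases hA : A.det = 0
    · exact ⟨1, one_ne_zero, fun h => absurd hA h⟩
    · obtain ⟨δ, hδ0, hδ⟩ := exists_pos_forall_approximatesLinearOn_addHaar_eq_zero μ hA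
      exact ⟨δ, hδ0.ne', fun _ => hδ f⟩
  choose δ hδ0 hδ using hδ
  obtain ⟨t, A, -, -, hst, happ, hA⟩ :=
    exists_partition_approximatesLinearOn_of_hasFDerivWithinAt f s f' hf' δ hδ0
  rw [← inter_eq_self_of_subset_left hst, inter_iUnion]
  refine measure_iUnion_null fun n => ?_
  obtain ⟨x, hx, hAx⟩ := hA hne n
  exact hδ (A n) (hAx ▸ hdet x hx) _ (happ n)
    (measure_mono_null (image_mono inter_subset_left) hs)

/-- The image of the critical set need not be Borel, but it is so up to a null set of the
pushforward: a σ-compact set of full measure in `criticalSet f` has a σ-compact image. -/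
theorem exists_measurableSet_subset_image_criticalSet (hf : Continuous f)
    (hd : ∀ᵐ x ∂μ, DifferentiableAt ℝ f x) :
    ∃ t ⊆ f '' criticalSet f, MeasurableSet t ∧ (μ.map f).restrict tᶜ ≪ μ := by
  obtain ⟨c, hc, hcσ, hc0⟩ :=
    exists_isSigmaCompact_subset_measure_sdiff_eq_zero μ (measurableSet_criticalSet f)
  have ht : MeasurableSet (f '' c) := measurableSet_of_isSigmaCompact (hcσ.image hf)
  refine ⟨f '' c, image_mono hc, ht, Measure.AbsolutelyContinuous.mk fun N hN hN0 => ?_⟩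
  rw [Measure.restrict_apply hN, Measure.map_apply hf.measurable (hN.inter ht.compl)]
  have hregular : μ {x | DifferentiableAt ℝ f x ∧ (fderiv ℝ f x).det ≠ 0 ∧ f x ∈ N} = 0 :=
    addHaar_eq_zero_of_addHaar_image_eq_zero μ
      (fun x hx => hx.1.hasFDerivAt.hasFDerivWithinAt) (fun x hx => hx.2.1)
      (measure_mono_null (image_subset_iff.2 fun x hx => hx.2.2) hN0)
  refine measure_mono_null (fun x hx => ?_)
    (measure_union_null (measure_union_null hd hregular) hc0)
  by_cases hdx : DifferentiableAt ℝ f x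
  · by_cases hdet : (fderiv ℝ f x).det = 0
    · exact Or.inr ⟨⟨hdx, hdet⟩, fun hxc => hx.2 (mem_image_of_mem f hxc)⟩
    · exact Or.inl (Or.inr ⟨hdx, hdet, hx.1⟩)
  · exact Or.inl (Or.inl hdx)

theorem isLebesgueDecomposition_map (hf : Continuous f) (hd : ∀ᵐ x ∂μ, DifferentiableAt ℝ f x) :
    IsLebesgueDecomposition (μ.map f) μ ((μ.map f).restrict (f '' criticalSet f)ᶜ)
      ((μ.map f).restrict (f '' criticalSet f)) := by
  obtain ⟨t, hts, ht, hac⟩ := exists_measurableSet_subset_image_criticalSet μ hf hd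
  exact isLebesgueDecomposition_restrict ht hts (addHaar_image_criticalSet μ f) hac

end AreaFormula

end Decomposition

section Flow

theorem le_exp_mul_of_deriv_le {g g' : ℝ → ℝ} {a b α β : ℝ} (hab : a ≤ b) (hα : 0 ≤ α)
    (hβ : 0 ≤ β) (hg : ContinuousOn g (Icc a b)) (hg' : ∀ t ∈ Ioo a b, HasDerivAt g (g' t) t)
    (h : ∀ t ∈ Ioo a b, g' t ≤ α * g t + β) :
    g b ≤ Real.exp (α * (b - a)) * (g a + β * (b - a)) := by
  set G : ℝ → ℝ := fun t => Real.exp (-(α * (t - a))) * g t - β * (t - a) with hG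
  have hder : ∀ t ∈ Ioo a b,
      HasDerivAt G (Real.exp (-(α * (t - a))) * (g' t - α * g t) - β) t := fun t ht => by
    have hsub : HasDerivAt (fun t : ℝ => t - a) 1 t := (hasDerivAt_id t).sub_const a
    exact ((((hsub.const_mul α).neg.exp).mul (hg' t ht)).sub (hsub.const_mul β)).congr_deriv
      (by simp only [Pi.neg_apply]; ring)
  have hanti : AntitoneOn G (Icc a b) := by
    refine antitoneOn_of_deriv_nonpos (convex_Icc a b) (by fun_prop) ?_ ?_ <;> rw [interior_Icc]
    · exact fun t ht => (hder t ht).differentiableAt.differentiableWithinAt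
    · intro t ht
      have hexp : Real.exp (-(α * (t - a))) ≤ 1 :=
        Real.exp_le_one_iff.2 (neg_nonpos.2 (mul_nonneg hα (sub_nonneg.2 ht.1.le)))
      rw [(hder t ht).deriv, sub_nonpos]
      calc Real.exp (-(α * (t - a))) * (g' t - α * g t)
          ≤ Real.exp (-(α * (t - a))) * β := by gcongr; linarith [h t ht]
        _ ≤ β := mul_le_of_le_one_left hβ hexp
  have hle := hanti (left_mem_Icc.2 hab) (right_mem_Icc.2 hab) hab
  simp only [hG, sub_self, mul_zero, neg_zero, Real.exp_zero, one_mul, sub_zero] at hle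
  rwa [Real.exp_neg, sub_le_iff_le_add, inv_mul_le_iff₀ (Real.exp_pos _)] at hle

section Comparison

variable {E : Type*} [NormedAddCommGroup E] [InnerProductSpace ℝ E] {X Y X' Y' : ℝ → E}
  {a b lam : ℝ}

theorem norm_sub_sq_le_of_inner_le {c : ℝ} (hab : a ≤ b)
    (hlam : 0 ≤ lam) (hc : 0 ≤ c) (hX : ContinuousOn X (Icc a b)) (hY : ContinuousOn Y (Icc a b))
    (hX' : ∀ t ∈ Ioo a b, HasDerivAt X (X' t) t) (hY' : ∀ t ∈ Ioo a b, HasDerivAt Y (Y' t) t)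
    (h : ∀ t ∈ Ioo a b, inner ℝ (X' t - Y' t) (X t - Y t) ≤ lam * ‖X t - Y t‖ ^ 2 + c) :
    ‖X b - Y b‖ ^ 2 ≤ Real.exp (2 * lam * (b - a)) * (‖X a - Y a‖ ^ 2 + 2 * c * (b - a)) :=
  le_exp_mul_of_deriv_le (g := fun t => ‖X t - Y t‖ ^ 2) hab (by positivity) (by positivity)
    (by fun_prop) (fun t ht => ((hX' t ht).sub (hY' t ht)).norm_sq) fun t ht => by
      rw [Pi.sub_apply, real_inner_comm]
      linarith [h t ht]

theorem norm_sub_le_of_inner_le (hab : a ≤ b) (hlam : 0 ≤ lam)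
    (hX : ContinuousOn X (Icc a b)) (hY : ContinuousOn Y (Icc a b))
    (hX' : ∀ t ∈ Ioo a b, HasDerivAt X (X' t) t) (hY' : ∀ t ∈ Ioo a b, HasDerivAt Y (Y' t) t)
    (h : ∀ t ∈ Ioo a b, inner ℝ (X' t - Y' t) (X t - Y t) ≤ lam * ‖X t - Y t‖ ^ 2) :
    ‖X b - Y b‖ ≤ Real.exp (lam * (b - a)) * ‖X a - Y a‖ := by
  refine le_of_sq_le_sq ?_ (by positivity)
  calc ‖X b - Y b‖ ^ 2
      ≤ Real.exp (2 * lam * (b - a)) * (‖X a - Y a‖ ^ 2 + 2 * 0 * (b - a)) :=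
        norm_sub_sq_le_of_inner_le hab hlam le_rfl hX hY hX' hY' (by simpa using h)
    _ = (Real.exp (lam * (b - a)) * ‖X a - Y a‖) ^ 2 := by
        rw [mul_pow, ← Real.exp_nat_mul]
        push_cast
        ring_nf

theorem norm_sub_le_of_isIntegralCurveOn {v : ℝ → E → E} {s : Set ℝ} (hlam : 0 ≤ lam)
    (hv : ∀ t ∈ Ioo a b, ∀ x x', inner ℝ (v t x - v t x') (x - x') ≤ lam * ‖x - x'‖ ^ 2)
    (hX : IsIntegralCurveOn X v s) (hY : IsIntegralCurveOn Y v s) (hab : a ≤ b)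
    (hs : Icc a b ⊆ s) :
    ‖X b - Y b‖ ≤ Real.exp (lam * (b - a)) * ‖X a - Y a‖ :=
  have hmem : ∀ t ∈ Ioo a b, s ∈ 𝓝 t := fun _ ht =>
    mem_of_superset (Icc_mem_nhds ht.1 ht.2) hs
  norm_sub_le_of_inner_le hab hlam (hX.continuousOn.mono hs) (hY.continuousOn.mono hs)
    (fun t ht => (hX t (hs (Ioo_subset_Icc_self ht))).hasDerivAt (hmem t ht))
    (fun t ht => (hY t (hs (Ioo_subset_Icc_self ht))).hasDerivAt (hmem t ht))
    fun t ht => hv t ht _ _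

end Comparison

theorem exists_isIntegralCurveOn_Icc {E : Type*} [NormedAddCommGroup E] [NormedSpace ℝ E]
    [CompleteSpace E] {v : ℝ → E → E} {K L : ℝ≥0} {a b : ℝ} (hab : a ≤ b)
    (hbound : ∀ t ∈ Icc a b, ∀ x, ‖v t x‖ ≤ K) (hcont : ∀ x, ContinuousOn (v · x) (Icc a b))
    (hlip : ∀ t ∈ Icc a b, LipschitzWith L (v t)) (y : E) :
    ∃ X : ℝ → E, X a = y ∧ IsIntegralCurveOn X v (Icc a b) := by
  have hPL : IsPicardLindelof v (⟨a, left_mem_Icc.2 hab⟩ : Icc a b) y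
      (K * (b - a).toNNReal) 0 K L :=
    { lipschitzOnWith := fun t ht => (hlip t ht).lipschitzOnWith
      continuousOn := fun x _ => hcont x
      norm_le := fun t ht x _ => hbound t ht x
      mul_max_le := by simp [hab] }
  exact hPL.exists_eq_forall_mem_Icc_hasDerivWithinAt₀

section GlobalExistence

variable {E : Type*} [NormedAddCommGroup E] [InnerProductSpace ℝ E] {v : ℝ → E → E} {K : ℝ≥0}
  {lam : ℝ} {y : E} {X : ℝ → ℝ → E}

theorem norm_sub_le_of_isIntegralCurveOn_Icc {Y : ℝ → E} {a b : ℝ} (hab : a ≤ b)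
    (hbound : ∀ t ∈ Ico a b, ∀ x, ‖v t x‖ ≤ K) (hY : IsIntegralCurveOn Y v (Icc a b)) :
    ‖Y b - Y a‖ ≤ K * (b - a) :=
  norm_image_sub_le_of_norm_deriv_le_segment' hY (fun t ht => hbound t ht _) b
    (right_mem_Icc.2 hab)

theorem norm_sub_le_of_isIntegralCurveOn_Ici (hlam : 0 ≤ lam)
    (hbound : ∀ t, 0 < t → ∀ x, ‖v t x‖ ≤ K)
    (hv : ∀ t, 0 < t → ∀ x x', inner ℝ (v t x - v t x') (x - x') ≤ lam * ‖x - x'‖ ^ 2)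
    (hy : ∀ a, 0 < a → X a a = y) (hX : ∀ a, 0 < a → IsIntegralCurveOn (X a) v (Ici a))
    {a a' t : ℝ} (ha : 0 < a) (ha' : 0 < a') (hat : a ≤ t) (hat' : a' ≤ t) :
    ‖X a t - X a' t‖ ≤ Real.exp (lam * t) * (K * max a a') := by
  wlog haa : a ≤ a' generalizing a a'
  · rw [norm_sub_rev, max_comm]
    exact this ha' ha hat' hat (le_of_not_ge haa)
  have hinit : ‖X a a' - X a' a'‖ ≤ K * (a' - a) := by
    rw [hy a' ha', ← hy a ha]
    exact norm_sub_le_of_isIntegralCurveOn_Icc haa (fun t ht => hbound t (ha.trans_le ht.1))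
      ((hX a ha).mono Icc_subset_Ici_self)
  calc ‖X a t - X a' t‖ ≤ Real.exp (lam * (t - a')) * ‖X a a' - X a' a'‖ :=
        norm_sub_le_of_isIntegralCurveOn hlam (fun r hr => hv r (ha'.trans hr.1))
          ((hX a ha).mono (Ici_subset_Ici.2 haa)) (hX a' ha') hat' Icc_subset_Ici_self
    _ ≤ Real.exp (lam * t) * (K * max a a') := by
        rw [max_eq_right haa]
        gcongr
        · linarith
        · exact hinit.trans (by gcongr; linarith)

variable [CompleteSpace E]

theorem exists_tendsto_of_isIntegralCurveOn_Ici (hlam : 0 ≤ lam)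
    (hbound : ∀ t, 0 < t → ∀ x, ‖v t x‖ ≤ K)
    (hv : ∀ t, 0 < t → ∀ x x', inner ℝ (v t x - v t x') (x - x') ≤ lam * ‖x - x'‖ ^ 2)
    (hy : ∀ a, 0 < a → X a a = y) (hX : ∀ a, 0 < a → IsIntegralCurveOn (X a) v (Ici a))
    {t : ℝ} (ht : 0 < t) : ∃ z, Tendsto (X · t) (𝓝[>] 0) (𝓝 z) := by
  have hmax : Tendsto (fun p : ℝ × ℝ => Real.exp (lam * t) * (K * max p.1 p.2))
      (𝓝[>] 0 ×ˢ 𝓝[>] 0) (𝓝 0) := by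
    have hcts : Continuous fun p : ℝ × ℝ => Real.exp (lam * t) * (K * max p.1 p.2) := by fun_prop
    have h0 := hcts.tendsto (0, 0)
    rw [nhds_prod_eq] at h0
    simpa using h0.mono_left (prod_mono nhdsWithin_le_nhds nhdsWithin_le_nhds)
  refine cauchy_map_iff_exists_tendsto.1 (cauchy_map_iff.2 ⟨inferInstance,
    tendsto_uniformity_iff_dist_tendsto_zero.2
      (squeeze_zero' (Eventually.of_forall fun _ => dist_nonneg) ?_ hmax)⟩)
  filter_upwards [prod_mem_prod (Ioc_mem_nhdsGT ht) (Ioc_mem_nhdsGT ht)] with p hp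
  rw [dist_eq_norm]
  exact norm_sub_le_of_isIntegralCurveOn_Ici hlam hbound hv hy hX hp.1.1 hp.2.1 hp.1.2 hp.2.2

variable (hlam : 0 ≤ lam) (hbound : ∀ t, 0 < t → ∀ x, ‖v t x‖ ≤ K)
  (hcont : ∀ x, ContinuousOn (v · x) (Ioi 0))
  (hlip : ∀ a b, 0 < a → ∃ L : ℝ≥0, ∀ t ∈ Icc a b, LipschitzWith L (v t))
  (hv : ∀ t, 0 < t → ∀ x x', inner ℝ (v t x - v t x') (x - x') ≤ lam * ‖x - x'‖ ^ 2)

include hlam hbound hcont hlip hv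

theorem exists_isIntegralCurveOn_Ici {a : ℝ} (ha : 0 < a) (y : E) :
    ∃ X : ℝ → E, X a = y ∧ IsIntegralCurveOn X v (Ici a) := by
  have hIcc : ∀ b, ∃ X : ℝ → E, X a = y ∧ (a ≤ b → IsIntegralCurveOn X v (Icc a b)) := by
    intro b
    rcases le_or_gt a b with hab | hba
    · obtain ⟨L, hL⟩ := hlip a b ha
      obtain ⟨X, hXa, hX⟩ := exists_isIntegralCurveOn_Icc hab
        (fun t ht => hbound t (ha.trans_le ht.1))
        (fun x => (hcont x).mono fun t ht => ha.trans_le ht.1) hL y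
      exact ⟨X, hXa, fun _ => hX⟩
    · exact ⟨fun _ => y, rfl, fun h => absurd h hba.not_ge⟩
  choose X hXa hX using hIcc
  have hunique : ∀ {b c t}, a ≤ t → t ≤ b → t ≤ c → X b t = X c t := fun {b c t} hat hb hc => by
    have hle := norm_sub_le_of_isIntegralCurveOn hlam (fun r hr => hv r (ha.trans hr.1))
      ((hX b (hat.trans hb)).mono (Icc_subset_Icc_right hb))
      ((hX c (hat.trans hc)).mono (Icc_subset_Icc_right hc)) hat subset_rfl
    simpa [hXa, sub_eq_zero] using hle
  refine ⟨fun t => X (t + 1) t, hXa _, fun t ht => ?_⟩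
  have hnhds : Icc a (t + 1) ∈ 𝓝[Ici a] t := by
    rw [← Ici_inter_Iic]
    exact inter_mem self_mem_nhdsWithin (nhdsWithin_le_nhds (Iic_mem_nhds (lt_add_one t)))
  have htIcc : t ∈ Icc a (t + 1) := ⟨ht, (lt_add_one t).le⟩
  exact ((hX _ (ht.trans htIcc.2) t htIcc).mono_of_mem_nhdsWithin hnhds).congr_of_eventuallyEq
    (mem_of_superset hnhds fun r hr => hunique hr.1 (lt_add_one r).le hr.2) rfl

theorem isIntegralCurveOn_Ioi_of_tendsto {Z : ℝ → E}
    (hX : ∀ a, 0 < a → IsIntegralCurveOn (X a) v (Ici a))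
    (hZ : ∀ t, 0 < t → Tendsto (X · t) (𝓝[>] 0) (𝓝 (Z t))) :
    IsIntegralCurveOn Z v (Ioi 0) := by
  have hIci : ∀ a, 0 < a → IsIntegralCurveOn Z v (Ici a) := by
    intro a ha
    obtain ⟨Y, hYa, hY⟩ := exists_isIntegralCurveOn_Ici hlam hbound hcont hlip hv ha (Z a)
    suffices hZY : EqOn Z Y (Ici a) from fun t ht => by
      rw [hZY ht]
      exact (hY t ht).congr hZY (hZY ht)
    intro t ht
    have hlim : Tendsto (fun c => Real.exp (lam * (t - a)) * ‖X c a - Y a‖) (𝓝[>] 0) (𝓝 0) := by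
      simpa [hYa] using ((hZ a ha).sub_const (Z a)).norm.const_mul (Real.exp (lam * (t - a)))
    refine tendsto_nhds_unique (hZ t (ha.trans_le ht)) (tendsto_iff_norm_sub_tendsto_zero.2
      (squeeze_zero' (Eventually.of_forall fun _ => norm_nonneg _) ?_ hlim))
    filter_upwards [Ioc_mem_nhdsGT ha] with c hc
    exact norm_sub_le_of_isIntegralCurveOn hlam (fun r hr => hv r (ha.trans hr.1))
      ((hX c hc.1).mono (Ici_subset_Ici.2 hc.2)) hY ht Icc_subset_Ici_self
  intro t ht
  have ht2 : t / 2 < t := half_lt_self ht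
  exact ((hIci _ (half_pos ht) t ht2.le).hasDerivAt (Ici_mem_nhds ht2)).hasDerivWithinAt

/-- Near the initial time the field is only assumed bounded: the Lipschitz constants may blow up at
`0`, and the solution is the limit of those started at `y` at small positive times. -/
theorem exists_continuousOn_hasDerivAt (y : E) :
    ∃ Z : ℝ → E, Z 0 = y ∧ ContinuousOn Z (Ici 0) ∧
      ∀ t, 0 < t → HasDerivAt Z (v t (Z t)) t := by
  choose! X hy hX using fun a (ha : 0 < a) =>
    exists_isIntegralCurveOn_Ici hlam hbound hcont hlip hv ha y
  have hlim : ∀ t, ∃ z, (t = 0 → z = y) ∧ (0 < t → Tendsto (X · t) (𝓝[>] 0) (𝓝 z)) := by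
    intro t
    rcases le_or_gt t 0 with ht | ht
    · exact ⟨y, fun _ => rfl, fun h => absurd h ht.not_gt⟩
    · obtain ⟨z, hz⟩ := exists_tendsto_of_isIntegralCurveOn_Ici hlam hbound hv hy hX ht
      exact ⟨z, fun h => absurd h ht.ne', fun _ => hz⟩
  choose Z hZ0 hZ using hlim
  have hZd := isIntegralCurveOn_Ioi_of_tendsto hlam hbound hcont hlip hv hX hZ
  have hderiv : ∀ t, 0 < t → HasDerivAt Z (v t (Z t)) t := fun t ht =>
    (hZd t ht).hasDerivAt (Ioi_mem_nhds ht)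
  have hZy : ∀ t ∈ Ici (0 : ℝ), ‖Z t - y‖ ≤ K * t := by
    intro t ht
    rcases (mem_Ici.1 ht).eq_or_lt with rfl | ht
    · simp [hZ0 0 rfl]
    refine le_of_tendsto ((hZ t ht).sub_const y).norm ?_
    filter_upwards [Ioc_mem_nhdsGT ht] with a ha
    rw [← hy a ha.1]
    exact (norm_sub_le_of_isIntegralCurveOn_Icc ha.2
      (fun r hr => hbound r (ha.1.trans_le hr.1)) ((hX a ha.1).mono Icc_subset_Ici_self)).trans
      (by gcongr; linarith [ha.1])
  refine ⟨Z, hZ0 0 rfl, fun t ht => ?_, hderiv⟩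
  rcases (mem_Ici.1 ht).eq_or_lt with rfl | ht
  · have hlin : Tendsto (fun t : ℝ => K * t) (𝓝[≥] 0) (𝓝 0) := by
      simpa using ((continuous_const_mul (K : ℝ)).tendsto 0).mono_left nhdsWithin_le_nhds
    rw [ContinuousWithinAt, hZ0 0 rfl, tendsto_iff_norm_sub_tendsto_zero]
    exact squeeze_zero' (Eventually.of_forall fun _ => norm_nonneg _)
      (mem_of_superset self_mem_nhdsWithin hZy) hlin
  · exact (hderiv t ht).continuousAt.continuousWithinAt

end GlobalExistence

end Flow

section LogIntegralExp

variable {α : Type*} [MeasurableSpace α] {μ : Measure α}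

theorem convexOn_log_integral_exp [NeZero μ] {E : Type*} [AddCommMonoid E] [Module ℝ E]
    {s : Set E} {g : E → α → ℝ} (hs : Convex ℝ s) (hg : ∀ z, ConvexOn ℝ s (g · z))
    (hint : ∀ x ∈ s, Integrable (fun z => Real.exp (g x z)) μ) :
    ConvexOn ℝ s fun x => Real.log (∫ z, Real.exp (g x z) ∂μ) := by
  set A : E → ℝ := fun x => Real.log (∫ z, Real.exp (g x z) ∂μ) with hA
  have hpos : ∀ x ∈ s, 0 < ∫ z, Real.exp (g x z) ∂μ := fun x hx => integral_exp_pos (hint x hx)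
  have hmul : ∀ x c z, Real.exp (g x z - c) = Real.exp (-c) * Real.exp (g x z) := fun x c z => by
    rw [← Real.exp_add, neg_add_eq_sub]
  have hint' : ∀ x ∈ s, ∀ c, Integrable (fun z => Real.exp (g x z - c)) μ := fun x hx c => by
    simpa only [hmul] using (hint x hx).const_mul _
  have hone : ∀ x ∈ s, ∫ z, Real.exp (g x z - A x) ∂μ = 1 := fun x hx => by
    simp only [hmul, hA, integral_const_mul, Real.exp_neg, Real.exp_log (hpos x hx)]
    exact inv_mul_cancel₀ (hpos x hx).ne'
  refine ⟨hs, fun x hx y hy a b ha hb hab => ?_⟩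
  have hxy := hs hx hy ha hb hab
  suffices h : ∫ z, Real.exp (g (a • x + b • y) z - (a • A x + b • A y)) ∂μ ≤ 1 by
    simp only [hmul, integral_const_mul, Real.exp_neg] at h
    rwa [inv_mul_le_iff₀ (Real.exp_pos _), mul_one, ← Real.log_le_iff_le_exp (hpos _ hxy)] at h
  calc ∫ z, Real.exp (g (a • x + b • y) z - (a • A x + b • A y)) ∂μ
      ≤ ∫ z, (a * Real.exp (g x z - A x) + b * Real.exp (g y z - A y)) ∂μ := by
        refine integral_mono (hint' _ hxy _)
          (((hint' x hx _).const_mul a).add ((hint' y hy _).const_mul b)) fun z => ?_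
        refine (Real.exp_le_exp.2 ?_).trans
          (convexOn_exp.2 (mem_univ (g x z - A x)) (mem_univ (g y z - A y)) ha hb hab)
        have := (hg z).2 hx hy ha hb hab
        simp only [smul_eq_mul] at this ⊢
        linarith
    _ = 1 := by
        rw [integral_add ((hint' x hx _).const_mul a) ((hint' y hy _).const_mul b),
          integral_const_mul, integral_const_mul, hone x hx, hone y hy, mul_one, mul_one, hab]

end LogIntegralExp

section Semiconcave

variable {E : Type*} [NormedAddCommGroup E] [InnerProductSpace ℝ E] {f : E → ℝ} {lam : ℝ}

theorem le_add_inner_of_concaveOn_sub_sq [CompleteSpace E]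
    (hf : ConcaveOn ℝ univ fun y => f y - lam / 2 * ‖y‖ ^ 2) {g x : E}
    (hg : HasGradientAt f g x) (y : E) :
    f y ≤ f x + inner ℝ g (y - x) + lam / 2 * ‖y - x‖ ^ 2 := by
  set h : ℝ → ℝ := (fun y => f y - lam / 2 * ‖y‖ ^ 2) ∘ AffineMap.lineMap x y with hh
  have hconc : ConcaveOn ℝ univ h := hf.comp_affineMap (AffineMap.lineMap x y)
  have hderiv : HasDerivAt h (inner ℝ g (y - x) - lam * inner ℝ x (y - x)) 0 := by
    have hline : HasDerivAt (AffineMap.lineMap x y : ℝ → E) (y - x) 0 :=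
      AffineMap.hasDerivAt_lineMap
    have hfline : HasDerivAt (f ∘ (AffineMap.lineMap x y : ℝ → E)) (inner ℝ g (y - x)) 0 := by
      have hg' := hg.hasFDerivAt
      rw [← AffineMap.lineMap_apply_zero (k := ℝ) x y] at hg'
      exact hg'.comp_hasDerivAt 0 hline
    refine (hfline.sub (hline.norm_sq.const_mul (lam / 2))).congr_deriv ?_
    rw [AffineMap.lineMap_apply_zero]
    ring
  have hslope := hconc.slope_le_of_hasDerivAt (mem_univ 0) (mem_univ 1) one_pos hderiv
  simp only [slope_def_field, hh, Function.comp_apply, AffineMap.lineMap_apply_zero,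
    AffineMap.lineMap_apply_one, sub_zero, div_one] at hslope
  rw [inner_sub_right x, real_inner_self_eq_norm_sq] at hslope
  rw [norm_sub_sq_real, real_inner_comm x y]
  linarith

theorem inner_sub_le_of_concaveOn_sub_sq [CompleteSpace E] {g : E → ℝ}
    (hf : ConcaveOn ℝ univ fun y => f y - lam / 2 * ‖y‖ ^ 2)
    (hg : ConcaveOn ℝ univ fun y => g y - lam / 2 * ‖y‖ ^ 2) {x y p q : E}
    (hp : HasGradientAt f p x) (hq : HasGradientAt g q y) {η : ℝ} (h : ∀ z, |f z - g z| ≤ η) :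
    inner ℝ (p - q) (x - y) ≤ lam * ‖x - y‖ ^ 2 + 2 * η := by
  have hxy := le_add_inner_of_concaveOn_sub_sq hf hp y
  have hyx := le_add_inner_of_concaveOn_sub_sq hg hq x
  rw [← neg_sub x y, inner_neg_right, norm_neg] at hxy
  rw [inner_sub_left]
  linarith [(abs_le.1 (h x)).2, (abs_le.1 (h y)).1]

theorem add_le_of_concaveOn_sub_sq (hf : ConcaveOn ℝ univ fun y => f y - lam / 2 * ‖y‖ ^ 2)
    (y z : E) : f (y + z) + f (y - z) ≤ 2 * f y + lam * ‖z‖ ^ 2 := by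
  have hmid := hf.2 (mem_univ (y + z)) (mem_univ (y - z)) (by norm_num : (0 : ℝ) ≤ 1 / 2)
    (by norm_num : (0 : ℝ) ≤ 1 / 2) (by norm_num)
  rw [show (1 / 2 : ℝ) • (y + z) + (1 / 2 : ℝ) • (y - z) = y by module] at hmid
  simp only [smul_eq_mul, norm_add_sq_real, norm_sub_sq_real] at hmid
  linarith

end Semiconcave

section Gaussian

variable {V : Type*} [NormedAddCommGroup V] [InnerProductSpace ℝ V] [FiniteDimensional ℝ V]
  [MeasurableSpace V] [BorelSpace V]

theorem integrable_exp_neg_mul_norm_sq {a : ℝ} (ha : 0 < a) :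
    Integrable fun z : V => Real.exp (-a * ‖z‖ ^ 2) := by
  refine Integrable.of_integral_ne_zero ?_
  rw [GaussianFourier.integral_rexp_neg_mul_sq_norm ha]
  exact (Real.rpow_pos_of_pos (div_pos Real.pi_pos ha) _).ne'

variable {F : V → ℝ} {a c : ℝ}

theorem exp_mul_integral_exp_neg_mul_norm_sq (ha : 0 < a) :
    Real.exp (-c + Module.finrank ℝ V / 2 * Real.log (Real.pi / a)) =
      ∫ z : V, Real.exp (-c) * Real.exp (-a * ‖z‖ ^ 2) := by
  rw [integral_const_mul, GaussianFourier.integral_rexp_neg_mul_sq_norm ha, Real.exp_add,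
    Real.rpow_def_of_pos (div_pos Real.pi_pos ha), mul_comm (Real.log _)]

theorem log_integral_exp_neg_le (ha : 0 < a) (hF : Integrable fun z => Real.exp (-F z))
    (hle : ∀ z, c + a * ‖z‖ ^ 2 ≤ F z) :
    Real.log (∫ z, Real.exp (-F z)) ≤
      -c + Module.finrank ℝ V / 2 * Real.log (Real.pi / a) := by
  rw [Real.log_le_iff_le_exp (integral_exp_pos hF), exp_mul_integral_exp_neg_mul_norm_sq ha]
  refine integral_mono hF ((integrable_exp_neg_mul_norm_sq ha).const_mul _) fun z => ?_
  rw [← Real.exp_add, Real.exp_le_exp]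
  linarith [hle z]

/-- Only the even part of `F` needs an upper bound, since averaging the integrand over `z ↦ -z` and
the convexity of `exp` replace `F` by its even part. -/
theorem le_log_integral_exp_neg (ha : 0 < a) (hF : Integrable fun z => Real.exp (-F z))
    (hle : ∀ z, F z + F (-z) ≤ 2 * (c + a * ‖z‖ ^ 2)) :
    -c + Module.finrank ℝ V / 2 * Real.log (Real.pi / a) ≤ Real.log (∫ z, Real.exp (-F z)) := by
  rw [Real.le_log_iff_exp_le (integral_exp_pos hF), exp_mul_integral_exp_neg_mul_norm_sq ha]
  calc ∫ z : V, Real.exp (-c) * Real.exp (-a * ‖z‖ ^ 2)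
      ≤ ∫ z, (1 / 2 * Real.exp (-F z) + 1 / 2 * Real.exp (-F (-z))) := by
        refine integral_mono ((integrable_exp_neg_mul_norm_sq ha).const_mul _)
          ((hF.const_mul _).add (hF.comp_neg.const_mul _)) fun z => ?_
        rw [← Real.exp_add]
        refine (Real.exp_le_exp.2 ?_).trans (convexOn_exp.2 (mem_univ (-F z)) (mem_univ (-F (-z)))
          (by norm_num) (by norm_num) (by norm_num))
        simp only [smul_eq_mul]
        linarith [hle z]
    _ = ∫ z, Real.exp (-F z) := by
        rw [integral_add (hF.const_mul _) (hF.comp_neg.const_mul _), integral_const_mul,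
          integral_const_mul, integral_neg_eq_self (fun z => Real.exp (-F z))]
        ring

end Gaussian

section GibbsWeight

variable {V : Type*} [NormedAddCommGroup V] {ψ : V → ℝ} {k : ℝ≥0} {s S : ℝ}

/-- The Gibbs weight `e^{-|z|²/s - ψ(x + z)}` of the displacement `z = y - x` in the Cole-Hopf
integral `∫ e^{-|x - y|²/s - ψ(y)} dy`; the viscous potential of `φ` at time `t` corresponds to
`ψ = φ / ε` and `s = 2εt`. -/
noncomputable def gibbsWeight (ψ : V → ℝ) (s : ℝ) (x z : V) : ℝ :=
  Real.exp (-(‖z‖ ^ 2 / s) - ψ (x + z))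

theorem gibbsWeight_pos (ψ : V → ℝ) (s : ℝ) (x z : V) : 0 < gibbsWeight ψ s x z :=
  Real.exp_pos _

theorem continuous_gibbsWeight (hψ : Continuous ψ) (s : ℝ) (x : V) :
    Continuous (gibbsWeight ψ s x) := by
  unfold gibbsWeight
  fun_prop

theorem gibbsWeight_le_exp_mul (hψ : LipschitzWith k ψ) (s : ℝ) (x x' z : V) :
    gibbsWeight ψ s x z ≤ Real.exp (k * ‖x - x'‖) * gibbsWeight ψ s x' z := by
  rw [gibbsWeight, gibbsWeight, ← Real.exp_add, Real.exp_le_exp]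
  have := (abs_le.1 (hψ.norm_sub_le (x + z) (x' + z))).1
  rw [add_sub_add_right_eq_sub] at this
  linarith

theorem norm_gibbsWeight_smul_le (hψ : LipschitzWith k ψ) {F : Type*} [NormedAddCommGroup F]
    [NormedSpace ℝ F] (hs : 0 < s) (hsS : s ≤ S) (x z : V) {w : F} (hw : ‖w‖ ≤ 1 + ‖z‖) :
    ‖gibbsWeight ψ s x z • w‖ ≤
      Real.exp ((k + 1) ^ 2 * S / 2 - ψ x) * Real.exp (-(2 * S)⁻¹ * ‖z‖ ^ 2) := by
  have hS : 0 < S := hs.trans_le hsS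
  have hsq : S⁻¹ * ‖z‖ ^ 2 ≤ ‖z‖ ^ 2 / s := by
    rw [div_eq_inv_mul]
    gcongr
  have hyoung : (k + 1) * ‖z‖ ≤ (k + 1) ^ 2 * S / 2 + (2 * S)⁻¹ * ‖z‖ ^ 2 := by
    have : 0 ≤ (2 * S)⁻¹ * ((k + 1) * S - ‖z‖) ^ 2 := by positivity
    field_simp at this ⊢
    linarith
  have hψz := (abs_le.1 (hψ.norm_sub_le (x + z) x)).1
  rw [add_sub_cancel_left] at hψz
  have hinv : S⁻¹ * ‖z‖ ^ 2 = 2 * ((2 * S)⁻¹ * ‖z‖ ^ 2) := by field_simp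
  rw [norm_smul, Real.norm_of_nonneg (gibbsWeight_pos ψ s x z).le, gibbsWeight]
  calc Real.exp (-(‖z‖ ^ 2 / s) - ψ (x + z)) * ‖w‖
      ≤ Real.exp (-(‖z‖ ^ 2 / s) - ψ (x + z)) * Real.exp ‖z‖ := by
        gcongr
        linarith [Real.add_one_le_exp ‖z‖]
    _ ≤ Real.exp ((k + 1) ^ 2 * S / 2 - ψ x) * Real.exp (-(2 * S)⁻¹ * ‖z‖ ^ 2) := by
        rw [← Real.exp_add, ← Real.exp_add, Real.exp_le_exp]
        linarith

theorem exp_mul_le_gibbsWeight (hψ : LipschitzWith k ψ) (hs : 0 < s) (hsS : s ≤ S) (x z : V) :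
    Real.exp (-(k ^ 2 / 4) - ψ x) * Real.exp (-(1 + s⁻¹) * ‖z‖ ^ 2) ≤ gibbsWeight ψ S x z := by
  have hsq : ‖z‖ ^ 2 / S ≤ s⁻¹ * ‖z‖ ^ 2 := by
    rw [div_eq_inv_mul]
    gcongr
  have hψz := (abs_le.1 (hψ.norm_sub_le (x + z) x)).2
  rw [add_sub_cancel_left] at hψz
  rw [gibbsWeight, ← Real.exp_add, Real.exp_le_exp]
  linarith [sq_nonneg ((k : ℝ) / 2 - ‖z‖)]

variable [InnerProductSpace ℝ V]

theorem hasFDerivAt_gibbsWeight_sub (ψ : V → ℝ) (s : ℝ) (x y : V) :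
    HasFDerivAt (fun x => gibbsWeight ψ s x (y - x))
      (innerSL ℝ ((2 / s) • gibbsWeight ψ s x (y - x) • (y - x))) x := by
  have hnorm := ((hasFDerivAt_id x).const_sub y).norm_sq
  simp only [gibbsWeight, add_sub_cancel, div_eq_mul_inv]
  refine (((hnorm.mul_const s⁻¹).fun_neg).sub_const (ψ y)).exp.congr_fderiv ?_
  ext v
  simp only [id_eq, map_sub, ContinuousLinearMap.comp_neg, ContinuousLinearMap.comp_id, neg_sub,
    smul_neg, neg_apply, smul_apply, sub_apply, coe_innerSL_apply, nsmul_eq_mul, Nat.cast_ofNat,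
    smul_eq_mul, map_smul]
  ring

theorem norm_gibbsWeight_smul_le_of_mem_ball (hψ : LipschitzWith k ψ) (hs : 0 < s) {x r : V}
    (hr : r ∈ Metric.ball x 1) (y : V) :
    ‖gibbsWeight ψ s r (y - r) • (y - r)‖ ≤ Real.exp ((k + 1) ^ 2 * s / 2 + k + (2 * s)⁻¹ - ψ x) *
      Real.exp (-(4 * s)⁻¹ * ‖y - x‖ ^ 2) := by
  rw [mem_ball_iff_norm] at hr
  have htri : ‖y - x‖ ≤ ‖y - r‖ + 1 := by
    linarith [norm_sub_le_norm_sub_add_norm_sub y r x]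
  have hsq : ‖y - x‖ ^ 2 ≤ 2 * ‖y - r‖ ^ 2 + 2 := by
    nlinarith [norm_nonneg (y - x), sq_nonneg (‖y - r‖ - 1)]
  have hdiv : (4 * s)⁻¹ * ‖y - x‖ ^ 2 ≤ (2 * s)⁻¹ * ‖y - r‖ ^ 2 + (2 * s)⁻¹ :=
    calc (4 * s)⁻¹ * ‖y - x‖ ^ 2 ≤ (4 * s)⁻¹ * (2 * ‖y - r‖ ^ 2 + 2) := by gcongr
      _ = (2 * s)⁻¹ * ‖y - r‖ ^ 2 + (2 * s)⁻¹ := by ring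
  have hψr : ψ x - k ≤ ψ r := by
    have hk : k * ‖r - x‖ ≤ k * 1 := by gcongr
    linarith [(abs_le.1 (hψ.norm_sub_le r x)).1]
  refine (norm_gibbsWeight_smul_le hψ hs le_rfl r (y - r) (by simp)).trans ?_
  rw [← Real.exp_add, ← Real.exp_add, Real.exp_le_exp]
  linarith

end GibbsWeight

section PartitionFunction

variable {V : Type*} [NormedAddCommGroup V] [InnerProductSpace ℝ V] [FiniteDimensional ℝ V]
  [MeasurableSpace V] [BorelSpace V] {ψ : V → ℝ} {k : ℝ≥0} {s : ℝ}

/-- The partition function `∫ e^{-|x - y|²/s - ψ(y)} dy`, written as an integral over the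
displacement `z = y - x`. -/
noncomputable def partitionFunction (ψ : V → ℝ) (s : ℝ) (x : V) : ℝ :=
  ∫ z, gibbsWeight ψ s x z

/-- The mean displacement `z = y - x` under the Gibbs probability density proportional to
`gibbsWeight ψ s x`; up to a scalar it is the gradient of the logarithm of the partition
function. -/
noncomputable def gibbsMean (ψ : V → ℝ) (s : ℝ) (x : V) : V :=
  (partitionFunction ψ s x)⁻¹ • ∫ z, gibbsWeight ψ s x z • z

theorem partitionFunction_eq_integral_sub (ψ : V → ℝ) (s : ℝ) (x y : V) :
    partitionFunction ψ s x = ∫ z, gibbsWeight ψ s x (z - y) :=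
  (integral_sub_right_eq_self (gibbsWeight ψ s x) y).symm

theorem integrable_gibbsWeight_smul {F : Type*} [NormedAddCommGroup F] [NormedSpace ℝ F]
    [SecondCountableTopology F] {w : V → F} (hψ : LipschitzWith k ψ) (hwc : Continuous w)
    (hw : ∀ z, ‖w z‖ ≤ 1 + ‖z‖) (hs : 0 < s) (x : V) :
    Integrable fun z => gibbsWeight ψ s x z • w z :=
  ((integrable_exp_neg_mul_norm_sq (by positivity : 0 < (2 * s)⁻¹)).const_mul _).mono'
    ((continuous_gibbsWeight hψ.continuous s x).smul hwc).aestronglyMeasurable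
    (Eventually.of_forall fun z => norm_gibbsWeight_smul_le hψ hs le_rfl x z (hw z))

theorem integrable_gibbsWeight (hψ : LipschitzWith k ψ) (hs : 0 < s) (x : V) :
    Integrable (gibbsWeight ψ s x) := by
  simpa using integrable_gibbsWeight_smul (w := fun _ => (1 : ℝ)) hψ continuous_const (by simp) hs x

theorem partitionFunction_pos (hψ : LipschitzWith k ψ) (hs : 0 < s) (x : V) :
    0 < partitionFunction ψ s x :=
  integral_exp_pos (integrable_gibbsWeight hψ hs x)

theorem lipschitzWith_log_partitionFunction (hψ : LipschitzWith k ψ) (hs : 0 < s) :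
    LipschitzWith k fun x => Real.log (partitionFunction ψ s x) := by
  refine LipschitzWith.of_le_add_mul k fun x x' => ?_
  have hx' := partitionFunction_pos hψ hs x'
  rw [Real.log_le_iff_le_exp (partitionFunction_pos hψ hs x), Real.exp_add, Real.exp_log hx',
    mul_comm, partitionFunction, partitionFunction, ← integral_const_mul, dist_eq_norm]
  exact integral_mono (integrable_gibbsWeight hψ hs x)
    ((integrable_gibbsWeight hψ hs x').const_mul _) (gibbsWeight_le_exp_mul hψ s x x')

theorem continuousOn_integral_gibbsWeight_smul {F : Type*} [NormedAddCommGroup F]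
    [NormedSpace ℝ F] [SecondCountableTopology F] {w : V → F} (hψ : LipschitzWith k ψ)
    (hwc : Continuous w) (hw : ∀ z, ‖w z‖ ≤ 1 + ‖z‖) (x : V) :
    ContinuousOn (fun s => ∫ z, gibbsWeight ψ s x z • w z) (Ioi 0) := by
  intro s (hs : 0 < s)
  have hbound := (integrable_exp_neg_mul_norm_sq (V := V)
    (by positivity : 0 < (2 * (s + 1))⁻¹)).const_mul (Real.exp ((k + 1) ^ 2 * (s + 1) / 2 - ψ x))
  refine (continuousAt_of_dominated (Eventually.of_forall fun r =>
      ((continuous_gibbsWeight hψ.continuous r x).smul hwc).aestronglyMeasurable) ?_ hbound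
    (Eventually.of_forall fun z => ?_)).continuousWithinAt
  · filter_upwards [Ioo_mem_nhds hs (lt_add_one s)] with r hr
    exact Eventually.of_forall fun z => norm_gibbsWeight_smul_le hψ hr.1 hr.2.le x z (hw z)
  · have hne := hs.ne'
    unfold gibbsWeight
    fun_prop (disch := assumption)

theorem continuousOn_gibbsMean (hψ : LipschitzWith k ψ) (x : V) :
    ContinuousOn (fun s => gibbsMean ψ s x) (Ioi 0) := by
  have hZ : ContinuousOn (fun s => partitionFunction ψ s x) (Ioi 0) := by
    simpa [partitionFunction] using
      continuousOn_integral_gibbsWeight_smul (w := fun _ => (1 : ℝ)) hψ continuous_const (by simp) x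
  exact (hZ.inv₀ fun s hs => (partitionFunction_pos hψ hs x).ne').smul
    (continuousOn_integral_gibbsWeight_smul hψ continuous_id (by simp) x)

theorem exists_integral_gibbsWeight_mul_norm_le (hψ : LipschitzWith k ψ) {a b : ℝ} (ha : 0 < a)
    (hb : 0 < b) : ∃ C : ℝ≥0, ∀ r ∈ Icc a b, ∀ x,
      ∫ z, gibbsWeight ψ r x z * ‖z‖ ≤ C * partitionFunction ψ r x := by
  have hA := integrable_exp_neg_mul_norm_sq (V := V) (by positivity : 0 < (2 * b)⁻¹)
  have hB := integrable_exp_neg_mul_norm_sq (V := V) (by positivity : 0 < 1 + a⁻¹)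
  set A := ∫ z : V, Real.exp (-(2 * b)⁻¹ * ‖z‖ ^ 2)
  set B := ∫ z : V, Real.exp (-(1 + a⁻¹) * ‖z‖ ^ 2)
  have hApos : 0 < A := integral_exp_pos hA
  have hBpos : 0 < B := integral_exp_pos hB
  refine ⟨⟨Real.exp ((k + 1) ^ 2 * b / 2 + k ^ 2 / 4) * A / B, by positivity⟩, fun r hr x => ?_⟩
  have hr0 : 0 < r := ha.trans_le hr.1
  have hupper : ∫ z, gibbsWeight ψ r x z * ‖z‖ ≤ Real.exp ((k + 1) ^ 2 * b / 2 - ψ x) * A := by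
    rw [← integral_const_mul]
    exact integral_mono (integrable_gibbsWeight_smul hψ continuous_norm (by simp) hr0 x)
      (hA.const_mul _) fun z => (le_abs_self _).trans
        (norm_gibbsWeight_smul_le (F := ℝ) hψ hr0 hr.2 x z (by simp))
  have hlower : Real.exp (-(k ^ 2 / 4) - ψ x) * B ≤ partitionFunction ψ r x := by
    rw [← integral_const_mul]
    exact integral_mono (hB.const_mul _) (integrable_gibbsWeight hψ hr0 x)
      (exp_mul_le_gibbsWeight hψ ha hr.1 x)
  calc ∫ z, gibbsWeight ψ r x z * ‖z‖ ≤ Real.exp ((k + 1) ^ 2 * b / 2 - ψ x) * A := hupper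
    _ = Real.exp ((k + 1) ^ 2 * b / 2 + k ^ 2 / 4) * A / B *
          (Real.exp (-(k ^ 2 / 4) - ψ x) * B) := by
        rw [show (k + 1) ^ 2 * b / 2 - ψ x =
          ((k + 1) ^ 2 * b / 2 + k ^ 2 / 4) + (-(k ^ 2 / 4) - ψ x) by ring, Real.exp_add]
        field_simp
    _ ≤ _ := mul_le_mul_of_nonneg_left hlower (by positivity)

theorem abs_sub_le_add_mul_abs_log_sub {p q : ℝ} (hp : 0 < p) (hq : 0 < q) :
    |p - q| ≤ (p + q) * |Real.log p - Real.log q| := by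
  wlog h : q ≤ p generalizing p q
  · rw [abs_sub_comm, abs_sub_comm (Real.log p), add_comm]
    exact this hq hp (le_of_not_ge h)
  have hlog := Real.log_le_sub_one_of_pos (div_pos hq hp)
  rw [Real.log_div hq.ne' hp.ne', le_sub_iff_add_le, le_div_iff₀ hp] at hlog
  have hmono := sub_nonneg.2 (Real.log_le_log hq h)
  rw [abs_of_nonneg (sub_nonneg.2 h), abs_of_nonneg hmono]
  nlinarith

theorem abs_inv_mul_gibbsWeight_sub_le (hψ : LipschitzWith k ψ) (hs : 0 < s) (x x' z : V) :
    |(partitionFunction ψ s x)⁻¹ * gibbsWeight ψ s x z -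
        (partitionFunction ψ s x')⁻¹ * gibbsWeight ψ s x' z| ≤
      2 * k * ‖x - x'‖ * ((partitionFunction ψ s x)⁻¹ * gibbsWeight ψ s x z +
        (partitionFunction ψ s x')⁻¹ * gibbsWeight ψ s x' z) := by
  have hlog : ∀ y, Real.log ((partitionFunction ψ s y)⁻¹ * gibbsWeight ψ s y z) =
      -Real.log (partitionFunction ψ s y) + (-(‖z‖ ^ 2 / s) - ψ (y + z)) := fun y => by
    rw [Real.log_mul (inv_pos.2 (partitionFunction_pos hψ hs y)).ne' (gibbsWeight_pos ψ s y z).ne',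
      Real.log_inv, gibbsWeight, Real.log_exp]
  have hpos : ∀ y, 0 < (partitionFunction ψ s y)⁻¹ * gibbsWeight ψ s y z := fun y =>
    mul_pos (inv_pos.2 (partitionFunction_pos hψ hs y)) (gibbsWeight_pos ψ s y z)
  refine (abs_sub_le_add_mul_abs_log_sub (hpos x) (hpos x')).trans ?_
  rw [mul_comm]
  refine mul_le_mul_of_nonneg_right ?_ (add_pos (hpos x) (hpos x')).le
  have hZ := abs_le.1 ((lipschitzWith_log_partitionFunction hψ hs).norm_sub_le x x')
  have hw := abs_le.1 (hψ.norm_sub_le (x + z) (x' + z))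
  rw [add_sub_add_right_eq_sub] at hw
  rw [hlog, hlog, abs_le]
  constructor <;> linarith [hZ.1, hZ.2, hw.1, hw.2]

theorem exists_lipschitzWith_gibbsMean (hψ : LipschitzWith k ψ) {a b : ℝ} (ha : 0 < a)
    (hb : 0 < b) : ∃ L : ℝ≥0, ∀ r ∈ Icc a b, LipschitzWith L (gibbsMean ψ r) := by
  obtain ⟨C, hC⟩ := exists_integral_gibbsWeight_mul_norm_le hψ ha hb
  refine ⟨4 * k * C, fun r hr => LipschitzWith.of_dist_le_mul fun x x' => ?_⟩
  have hr0 : 0 < r := ha.trans_le hr.1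
  set p : V → V → ℝ := fun x z => (partitionFunction ψ r x)⁻¹ * gibbsWeight ψ r x z with hp
  have hmean : ∀ x, gibbsMean ψ r x = ∫ z, p x z • z := fun x => by
    simp only [hp, gibbsMean, mul_smul, integral_smul]
  have hint : ∀ x, Integrable fun z => p x z • z := fun x => by
    simpa only [hp, mul_smul] using!
      (integrable_gibbsWeight_smul hψ continuous_id (by simp) hr0 x).smul
        (partitionFunction ψ r x)⁻¹
  have hint' : ∀ x, Integrable fun z => p x z * ‖z‖ := fun x => by
    simpa only [hp, mul_assoc, smul_eq_mul] using
      (integrable_gibbsWeight_smul hψ continuous_norm (by simp) hr0 x).const_mul _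
  have hle : ∀ x, ∫ z, p x z * ‖z‖ ≤ C := fun x => by
    simp only [hp, mul_assoc, integral_const_mul]
    rw [inv_mul_le_iff₀ (partitionFunction_pos hψ hr0 x), mul_comm]
    exact hC r hr x
  calc dist (gibbsMean ψ r x) (gibbsMean ψ r x')
      ≤ ∫ z, 2 * k * ‖x - x'‖ * (p x z * ‖z‖ + p x' z * ‖z‖) := by
        rw [hmean, hmean, dist_eq_norm, ← integral_sub (hint x) (hint x')]
        refine norm_integral_le_of_norm_le (((hint' x).add (hint' x')).const_mul _)
          (Eventually.of_forall fun z => ?_)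
        rw [← sub_smul, norm_smul, ← add_mul, ← mul_assoc]
        exact mul_le_mul_of_nonneg_right (abs_inv_mul_gibbsWeight_sub_le hψ hr0 x x' z)
          (norm_nonneg z)
    _ ≤ 2 * k * ‖x - x'‖ * (C + C) := by
        rw [integral_const_mul, integral_add (hint' x) (hint' x')]
        gcongr
        · exact hle x
        · exact hle x'
    _ = (4 * k * C : ℝ≥0) * dist x x' := by
        push_cast [dist_eq_norm]
        ring

theorem hasFDerivAt_partitionFunction (hψ : LipschitzWith k ψ) (hs : 0 < s) (x : V) :
    HasFDerivAt (partitionFunction ψ s)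
      (innerSL ℝ ((2 / s) • ∫ z, gibbsWeight ψ s x z • z)) x := by
  have hc := hψ.continuous
  have hint : Integrable fun y => gibbsWeight ψ s x (y - x) • (y - x) :=
    (integrable_gibbsWeight_smul hψ continuous_id (by simp) hs x).comp_sub_right x
  have hbound := ((integrable_exp_neg_mul_norm_sq (V := V)
    (by positivity : 0 < (4 * s)⁻¹)).comp_sub_right x).const_mul
      (2 / s * Real.exp ((k + 1) ^ 2 * s / 2 + k + (2 * s)⁻¹ - ψ x))
  have hderiv := hasFDerivAt_integral_of_dominated_of_fderiv_le (μ := volume)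
    (F := fun r y => gibbsWeight ψ s r (y - r)) (Metric.ball_mem_nhds x one_pos)
    (Eventually.of_forall fun r =>
      ((continuous_gibbsWeight hc s r).comp (continuous_sub_right r)).aestronglyMeasurable)
    ((integrable_gibbsWeight hψ hs x).comp_sub_right x)
    ((innerSL ℝ).continuous.comp_aestronglyMeasurable (hint.smul (2 / s)).aestronglyMeasurable)
    (Eventually.of_forall fun y r hr => ?_) hbound
    (Eventually.of_forall fun y r _ => hasFDerivAt_gibbsWeight_sub ψ s r y)
  · rw [← integral_sub_right_eq_self (fun z => gibbsWeight ψ s x z • z) x, ← integral_smul,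
      ← (innerSL ℝ).integral_comp_comm (by exact hint.smul (2 / s))]
    exact hderiv.congr_of_eventuallyEq
      (Eventually.of_forall fun r => partitionFunction_eq_integral_sub ψ s r r)
  · rw [innerSL_apply_norm, norm_smul, Real.norm_of_nonneg (by positivity : 0 ≤ 2 / s), mul_assoc]
    gcongr
    exact norm_gibbsWeight_smul_le_of_mem_ball hψ hs hr y

theorem hasGradientAt_log_partitionFunction (hψ : LipschitzWith k ψ) (hs : 0 < s) (x : V) :
    HasGradientAt (fun x => Real.log (partitionFunction ψ s x)) ((2 / s) • gibbsMean ψ s x) x := by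
  refine ((hasFDerivAt_partitionFunction hψ hs x).log
    (partitionFunction_pos hψ hs x).ne').congr_fderiv ?_
  rw [gibbsMean, smul_comm, ← map_smul]
  rfl

theorem convexOn_log_partitionFunction_add_sq {μ : ℝ} (hψ : LipschitzWith k ψ)
    (hconc : ConcaveOn ℝ univ fun y => ψ y - μ / 2 * ‖y‖ ^ 2) (hs : 0 < s) :
    ConvexOn ℝ univ fun x => Real.log (partitionFunction ψ s x) + μ / 2 * ‖x‖ ^ 2 := by
  have hexp : ∀ x z, Real.exp (-(‖z‖ ^ 2 / s) - ψ (x + z) + μ / 2 * ‖x‖ ^ 2) =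
      Real.exp (μ / 2 * ‖x‖ ^ 2) * gibbsWeight ψ s x z := fun x z => by
    rw [add_comm, Real.exp_add, gibbsWeight]
  have hconv : ∀ z, ConvexOn ℝ univ fun x =>
      -(‖z‖ ^ 2 / s) - ψ (x + z) + μ / 2 * ‖x‖ ^ 2 := by
    intro z
    have htrans := (hconc.neg.translate_left z).add
      (((-μ • innerSL ℝ z).toLinearMap.convexOn convex_univ).add_const
        (-(‖z‖ ^ 2 / s) - μ / 2 * ‖z‖ ^ 2))
    refine htrans.congr fun x _ => ?_
    simp only [neg_smul, ContinuousLinearMap.toLinearMap_neg,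
      ContinuousLinearMap.toLinearMap_smul, ContinuousLinearMap.toLinearMap_innerSL_apply,
      LinearMap.coe_neg, LinearMap.coe_smul, coe_innerₛₗ_apply, Pi.add_apply,
      Function.comp_apply, Pi.neg_apply, norm_add_sq_real, neg_sub, Pi.smul_apply,
      real_inner_comm x z, smul_eq_mul]
    ring
  refine (convexOn_log_integral_exp (μ := volume) convex_univ hconv fun x _ => ?_).congr
    fun x _ => ?_
  · simpa only [hexp] using (integrable_gibbsWeight hψ hs x).const_mul _
  · simp only [hexp, integral_const_mul, ← partitionFunction.eq_1]
    rw [Real.log_mul (Real.exp_pos _).ne' (partitionFunction_pos hψ hs x).ne', Real.log_exp,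
      add_comm]

theorem log_partitionFunction_le (hψ : LipschitzWith k ψ) (hs : 0 < s) {a c : ℝ} (ha : 0 < a)
    {x : V} (hc : ∀ z, c + a * ‖z‖ ^ 2 ≤ ‖z‖ ^ 2 / s + ψ (x + z)) :
    Real.log (partitionFunction ψ s x) ≤
      -c + Module.finrank ℝ V / 2 * Real.log (Real.pi / a) := by
  have hexp : ∀ z, gibbsWeight ψ s x z = Real.exp (-(‖z‖ ^ 2 / s + ψ (x + z))) := fun z => by
    rw [gibbsWeight, neg_add']
  have hint := integrable_gibbsWeight hψ hs x
  simp only [funext hexp] at hint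
  simpa only [partitionFunction, hexp] using log_integral_exp_neg_le ha hint hc

theorem le_log_partitionFunction {μ : ℝ} (hψ : LipschitzWith k ψ) (hμ : 0 ≤ μ)
    (hconc : ConcaveOn ℝ univ fun y => ψ y - μ / 2 * ‖y‖ ^ 2) (hs : 0 < s) (x y : V) :
    -(‖x - y‖ ^ 2 / s + ψ y) + Module.finrank ℝ V / 2 * Real.log (Real.pi / (s⁻¹ + μ / 2)) ≤
      Real.log (partitionFunction ψ s x) := by
  have hexp : ∀ z, gibbsWeight ψ s x (z - (x - y)) =
      Real.exp (-(‖x - y - z‖ ^ 2 / s + ψ (y + z))) := fun z => by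
    rw [gibbsWeight, neg_add', norm_sub_rev]
    abel_nf
  have hint := (integrable_gibbsWeight hψ hs x).comp_sub_right (x - y)
  simp only [hexp] at hint
  rw [partitionFunction_eq_integral_sub ψ s x (x - y)]
  simp only [hexp]
  refine le_log_integral_exp_neg (by positivity) hint fun z => ?_
  have hψ := add_le_of_concaveOn_sub_sq hconc y z
  have hpar := parallelogram_law_with_norm ℝ (x - y) z
  rw [sub_neg_eq_add, ← sub_eq_add_neg y z]
  calc ‖x - y - z‖ ^ 2 / s + ψ (y + z) + (‖x - y + z‖ ^ 2 / s + ψ (y - z))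
      = (‖x - y + z‖ ^ 2 + ‖x - y - z‖ ^ 2) / s + (ψ (y + z) + ψ (y - z)) := by
        ring
    _ ≤ 2 * (‖x - y‖ ^ 2 + ‖z‖ ^ 2) / s + (2 * ψ y + μ * ‖z‖ ^ 2) := by rw [hpar]; gcongr
    _ = 2 * (‖x - y‖ ^ 2 / s + ψ y + (s⁻¹ + μ / 2) * ‖z‖ ^ 2) := by ring

end PartitionFunction

theorem lipschitzWith_div_const {α : Type*} [PseudoMetricSpace α] {f : α → ℝ} {K : ℝ≥0}
    (hf : LipschitzWith K f) {c : ℝ} (hc : 0 < c) :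
    LipschitzWith (K / c.toNNReal) fun y => f y / c := by
  refine LipschitzWith.of_dist_le_mul fun x y => ?_
  rw [Real.dist_eq, ← sub_div, abs_div, abs_of_pos hc, NNReal.coe_div, Real.coe_toNNReal _ hc.le,
    div_mul_eq_mul_div, ← Real.dist_eq]
  exact div_le_div_of_nonneg_right (hf.dist_le_mul x y) hc.le

theorem concaveOn_div_const {E : Type*} [NormedAddCommGroup E] [NormedSpace ℝ E] {f : E → ℝ}
    {lam : ℝ} (hf : ConcaveOn ℝ univ fun y => f y - lam / 2 * ‖y‖ ^ 2) {c : ℝ} (hc : 0 < c) :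
    ConcaveOn ℝ univ fun y => f y / c - lam / c / 2 * ‖y‖ ^ 2 := by
  refine (hf.smul (inv_pos.2 hc).le).congr fun z _ => ?_
  simp only [smul_eq_mul]
  ring

section ViscousPotential

variable {d : ℕ} {φ : EuclideanSpace ℝ (Fin d) → ℝ} {K : ℝ≥0} {lam ε δ t : ℝ}

theorem viscousPotential_eq (hK : LipschitzWith K φ) (hε : 0 < ε) (ht : 0 < t)
    (x : EuclideanSpace ℝ (Fin d)) :
    viscousPotential φ ε t x = ε * (d / 2 * Real.log (2 * Real.pi * ε * t)) -
      ε * Real.log (partitionFunction (fun y => φ y / ε) (2 * ε * t) x) := by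
  have hZ := partitionFunction_pos (lipschitzWith_div_const hK hε) (by positivity : 0 < 2 * ε * t) x
  have hint : ∫ y, Real.exp (-(‖x - y‖ ^ 2 / (2 * ε * t)) - φ y / ε) =
      partitionFunction (fun y => φ y / ε) (2 * ε * t) x := by
    simp only [partitionFunction_eq_integral_sub _ _ x x, gibbsWeight, add_sub_cancel,
      norm_sub_rev x]
  have hpos : 0 < 2 * Real.pi * ε * t := by positivity
  rw [viscousPotential, hint, Real.log_mul (by positivity) hZ.ne', one_div, Real.log_inv,
    Real.log_rpow hpos]
  ring

theorem hasGradientAt_viscousPotential (hK : LipschitzWith K φ) (hε : 0 < ε) (ht : 0 < t)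
    (x : EuclideanSpace ℝ (Fin d)) :
    HasGradientAt (viscousPotential φ ε t)
      (-t⁻¹ • gibbsMean (fun y => φ y / ε) (2 * ε * t) x) x := by
  have hlog := hasGradientAt_log_partitionFunction (lipschitzWith_div_const hK hε)
    (by positivity : 0 < 2 * ε * t) x
  rw [funext (viscousPotential_eq hK hε ht)]
  refine ((hlog.hasFDerivAt.const_mul ε).const_sub _).congr_fderiv ?_
  rw [← map_smul, ← map_neg, smul_smul, ← neg_smul]
  congr 3
  field_simp

theorem lipschitzWith_viscousPotential (hK : LipschitzWith K φ) (hε : 0 < ε) (ht : 0 < t) :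
    LipschitzWith K (viscousPotential φ ε t) := by
  refine LipschitzWith.of_dist_le_mul fun x y => ?_
  have hlog := (lipschitzWith_log_partitionFunction (lipschitzWith_div_const hK hε)
    (by positivity : 0 < 2 * ε * t)).dist_le_mul x y
  rw [Real.dist_eq, NNReal.coe_div, Real.coe_toNNReal _ hε.le, div_mul_eq_mul_div,
    le_div_iff₀ hε] at hlog
  rwa [viscousPotential_eq hK hε ht, viscousPotential_eq hK hε ht, Real.dist_eq,
    sub_sub_sub_cancel_left, ← mul_sub, abs_mul, abs_of_pos hε, mul_comm ε, abs_sub_comm]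

theorem norm_gradient_viscousPotential_le (hK : LipschitzWith K φ) (hε : 0 < ε) (ht : 0 < t)
    (x : EuclideanSpace ℝ (Fin d)) : ‖gradient (viscousPotential φ ε t) x‖ ≤ K := by
  rw [gradient, LinearIsometryEquiv.norm_map]
  exact norm_fderiv_le_of_lipschitz ℝ (lipschitzWith_viscousPotential hK hε ht)

theorem continuousOn_gradient_viscousPotential (hK : LipschitzWith K φ) (hε : 0 < ε)
    (x : EuclideanSpace ℝ (Fin d)) :
    ContinuousOn (fun t => gradient (viscousPotential φ ε t) x) (Ioi 0) := by
  have hmaps : MapsTo (fun t : ℝ => 2 * ε * t) (Ioi 0) (Ioi 0) := fun t (ht : 0 < t) =>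
    mem_Ioi.2 (by positivity)
  have hmean := (continuousOn_gibbsMean (lipschitzWith_div_const hK hε) x).comp
    (continuous_const_mul (2 * ε)).continuousOn hmaps
  exact ((continuousOn_id.inv₀ fun t ht => (mem_Ioi.1 ht).ne').neg.smul hmean).congr
    fun t ht => (hasGradientAt_viscousPotential hK hε ht x).gradient

theorem exists_lipschitzWith_gradient_viscousPotential (hK : LipschitzWith K φ) (hε : 0 < ε)
    {a : ℝ} (ha : 0 < a) (b : ℝ) :
    ∃ L : ℝ≥0, ∀ t ∈ Icc a b, LipschitzWith L (gradient (viscousPotential φ ε t)) := by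
  rcases lt_or_ge b a with hab | hab
  · exact ⟨0, fun t ht => absurd (ht.1.trans ht.2) hab.not_ge⟩
  have hb : 0 < b := ha.trans_le hab
  obtain ⟨L, hL⟩ := exists_lipschitzWith_gibbsMean (lipschitzWith_div_const hK hε)
    (by positivity : 0 < 2 * ε * a) (by positivity : 0 < 2 * ε * b)
  refine ⟨Real.toNNReal a⁻¹ * L, fun t ht => LipschitzWith.of_dist_le_mul fun x y => ?_⟩
  have ht0 : 0 < t := ha.trans_le ht.1
  have hmean := (hL (2 * ε * t) ⟨by gcongr; exact ht.1, by gcongr; exact ht.2⟩).dist_le_mul x y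
  rw [(hasGradientAt_viscousPotential hK hε ht0 x).gradient,
    (hasGradientAt_viscousPotential hK hε ht0 y).gradient, dist_smul₀, norm_neg,
    Real.norm_of_nonneg (inv_pos.2 ht0).le, NNReal.coe_mul, Real.coe_toNNReal _ (inv_pos.2 ha).le,
    mul_assoc a⁻¹]
  exact mul_le_mul (inv_anti₀ ha ht.1) hmean dist_nonneg (inv_pos.2 ha).le

theorem concaveOn_viscousPotential_sub_sq (hK : LipschitzWith K φ)
    (hconc : ConcaveOn ℝ univ fun y => φ y - lam / 2 * ‖y‖ ^ 2) (hε : 0 < ε) (ht : 0 < t) :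
    ConcaveOn ℝ univ fun x => viscousPotential φ ε t x - lam / 2 * ‖x‖ ^ 2 := by
  have hlog := convexOn_log_partitionFunction_add_sq (lipschitzWith_div_const hK hε)
    (concaveOn_div_const hconc hε) (by positivity : 0 < 2 * ε * t)
  refine ((hlog.smul hε.le).neg.add_const
    (ε * (d / 2 * Real.log (2 * Real.pi * ε * t)))).congr fun x _ => ?_
  have hcancel : ε * (lam / ε / 2 * ‖x‖ ^ 2) = lam / 2 * ‖x‖ ^ 2 := by field_simp
  simp only [viscousPotential_eq hK hε ht, Pi.add_apply, Pi.neg_apply, smul_eq_mul, mul_add,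
    hcancel]
  ring

theorem inner_gradient_viscousPotential_sub_le {η : ℝ} (hK : LipschitzWith K φ)
    (hconc : ConcaveOn ℝ univ fun y => φ y - lam / 2 * ‖y‖ ^ 2) (hε : 0 < ε) (hδ : 0 < δ)
    (ht : 0 < t) (h : ∀ x, |viscousPotential φ ε t x - viscousPotential φ δ t x| ≤ η)
    (x y : EuclideanSpace ℝ (Fin d)) :
    inner ℝ (gradient (viscousPotential φ ε t) x - gradient (viscousPotential φ δ t) y) (x - y) ≤
      lam * ‖x - y‖ ^ 2 + 2 * η := by
  have hdiff {r : ℝ} (hr : 0 < r) (z : EuclideanSpace ℝ (Fin d)) :=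
    (hasGradientAt_viscousPotential hK hr ht z).differentiableAt.hasGradientAt
  exact inner_sub_le_of_concaveOn_sub_sq (concaveOn_viscousPotential_sub_sq hK hconc hε ht)
    (concaveOn_viscousPotential_sub_sq hK hconc hδ ht) (hdiff hε x) (hdiff hδ y) h

theorem inner_gradient_viscousPotential_sub_self_le (hK : LipschitzWith K φ)
    (hconc : ConcaveOn ℝ univ fun y => φ y - lam / 2 * ‖y‖ ^ 2) (hε : 0 < ε) (ht : 0 < t)
    (x y : EuclideanSpace ℝ (Fin d)) :
    inner ℝ (gradient (viscousPotential φ ε t) x - gradient (viscousPotential φ ε t) y) (x - y) ≤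
      lam * ‖x - y‖ ^ 2 := by
  simpa using inner_gradient_viscousPotential_sub_le (η := 0) hK hconc hε hε ht (by simp) x y

theorem exists_isViscousFlow (hK : LipschitzWith K φ) (hlam : 0 ≤ lam)
    (hconc : ConcaveOn ℝ univ fun y => φ y - lam / 2 * ‖y‖ ^ 2) (hε : 0 < ε) :
    ∃ X, IsViscousFlow φ ε X := by
  choose X hinit hcont hderiv using exists_continuousOn_hasDerivAt hlam
    (fun t ht => norm_gradient_viscousPotential_le hK hε ht)
    (continuousOn_gradient_viscousPotential hK hε)
    (fun a b ha => exists_lipschitzWith_gradient_viscousPotential hK hε ha b)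
    (fun t ht => inner_gradient_viscousPotential_sub_self_le hK hconc hε ht)
  exact ⟨X, hinit, hcont, hderiv⟩

theorem IsViscousFlow.lipschitzWith {X : EuclideanSpace ℝ (Fin d) → ℝ → EuclideanSpace ℝ (Fin d)}
    (hX : IsViscousFlow φ ε X) (hK : LipschitzWith K φ) (hlam : 0 ≤ lam)
    (hconc : ConcaveOn ℝ univ fun y => φ y - lam / 2 * ‖y‖ ^ 2) (hε : 0 < ε) (ht : 0 ≤ t) :
    LipschitzWith (Real.exp (lam * t)).toNNReal fun y => X y t := by
  refine LipschitzWith.of_dist_le_mul fun y z => ?_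
  have h := norm_sub_le_of_inner_le ht hlam
    ((hX.continuousOn y).mono Icc_subset_Ici_self) ((hX.continuousOn z).mono Icc_subset_Ici_self)
    (fun r hr => hX.hasDerivAt y r hr.1) (fun r hr => hX.hasDerivAt z r hr.1)
    (fun r hr => inner_gradient_viscousPotential_sub_self_le hK hconc hε hr.1 _ _)
  rwa [hX.initial, hX.initial, sub_zero, ← dist_eq_norm, ← dist_eq_norm,
    ← Real.coe_toNNReal _ (Real.exp_pos (lam * t)).le] at h

end ViscousPotential

section HopfLax

variable {E : Type*} [NormedAddCommGroup E] {φ : E → ℝ} {K : ℝ≥0} {ε t : ℝ}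

/-- The Hopf-Lax formula `inf_y (|x - y|²/(2t) + φ(y))`, the limit of the viscous potentials of `φ`
at time `t`. It is meant for `t > 0` and a Lipschitz function `φ`, so that the infimum is
finite. -/
noncomputable def hopfLax (φ : E → ℝ) (t : ℝ) (x : E) : ℝ :=
  ⨅ y, (‖x - y‖ ^ 2 / (2 * t) + φ y)

theorem hopfLax_le (hK : LipschitzWith K φ) (ht : 0 < t) (x y : E) :
    hopfLax φ t x ≤ ‖x - y‖ ^ 2 / (2 * t) + φ y := by
  refine ciInf_le ⟨φ x - K ^ 2 * t / 2, ?_⟩ y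
  rintro _ ⟨z, rfl⟩
  have hφ := (abs_le.1 (hK.norm_sub_le x z)).2
  have hsq : 0 ≤ (‖x - z‖ - K * t) ^ 2 / (2 * t) := by positivity
  have hexpand : (‖x - z‖ - K * t) ^ 2 / (2 * t) =
      ‖x - z‖ ^ 2 / (2 * t) - K * ‖x - z‖ + K ^ 2 * t / 2 := by
    field_simp
    ring
  simp only
  linarith

/-- Compare the Hopf-Lax infimum with its value at the point `y + ε(x - y)` of the segment from `y`
to `x`. -/
theorem hopfLax_add_mul_le [NormedSpace ℝ E] (hK : LipschitzWith K φ) (ht : 0 < t) (hε : 0 ≤ ε)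
    (hε' : ε ≤ 1) (x y : E) :
    hopfLax φ t x + ε * (‖x - y‖ ^ 2 / (4 * t) - K ^ 2 * t) ≤ ‖x - y‖ ^ 2 / (2 * t) + φ y := by
  have hcomp := hopfLax_le hK ht x (y + ε • (x - y))
  have hφ := (abs_le.1 (hK.norm_sub_le (y + ε • (x - y)) y)).2
  rw [show x - (y + ε • (x - y)) = (1 - ε) • (x - y) by module, norm_smul,
    Real.norm_of_nonneg (sub_nonneg.2 hε')] at hcomp
  rw [add_sub_cancel_left, norm_smul, Real.norm_of_nonneg hε] at hφ
  set r := ‖x - y‖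
  have hsq : 0 ≤ ε * ((r - 2 * K * t) ^ 2 / (4 * t)) := by positivity
  have hexpand : ε * ((r - 2 * K * t) ^ 2 / (4 * t)) =
      ε * (r ^ 2 / (4 * t) + K ^ 2 * t) - K * (ε * r) := by
    field_simp
    ring
  have hcoef : 0 ≤ ε * (1 - ε) * (r ^ 2 / (2 * t)) :=
    mul_nonneg (mul_nonneg hε (sub_nonneg.2 hε')) (by positivity)
  have hsplit : r ^ 2 / (2 * t) = ((1 - ε) * r) ^ 2 / (2 * t) + ε * (1 - ε) * (r ^ 2 / (2 * t)) +
      ε * (2 * (r ^ 2 / (4 * t))) := by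
    field_simp
    ring
  linarith

end HopfLax

section VanishingViscosity

variable {d : ℕ} {φ : EuclideanSpace ℝ (Fin d) → ℝ} {K : ℝ≥0} {lam ε δ t : ℝ}

theorem viscousPotential_le_hopfLax_add (hK : LipschitzWith K φ) (hlam : 0 ≤ lam)
    (hconc : ConcaveOn ℝ univ fun y => φ y - lam / 2 * ‖y‖ ^ 2) (hε : 0 < ε) (ht : 0 < t)
    (x : EuclideanSpace ℝ (Fin d)) :
    viscousPotential φ ε t x ≤ hopfLax φ t x + ε * (d / 2 * Real.log (1 + lam * t)) := by
  rw [← sub_le_iff_le_add]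
  refine le_ciInf fun y => ?_
  have hlog := mul_le_mul_of_nonneg_left (le_log_partitionFunction (lipschitzWith_div_const hK hε)
    (by positivity : 0 ≤ lam / ε) (concaveOn_div_const hconc hε) (by positivity : 0 < 2 * ε * t)
    x y) hε.le
  have hgauss : Real.log (Real.pi / ((2 * ε * t)⁻¹ + lam / ε / 2)) =
      Real.log (2 * Real.pi * ε * t) - Real.log (1 + lam * t) := by
    rw [← Real.log_div (by positivity) (by positivity)]
    congr 1
    field_simp
  have hcancel : ε * (‖x - y‖ ^ 2 / (2 * ε * t) + φ y / ε) = ‖x - y‖ ^ 2 / (2 * t) + φ y := by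
    field_simp
  rw [hgauss, finrank_euclideanSpace_fin] at hlog
  rw [viscousPotential_eq hK hε ht]
  linarith

theorem hopfLax_sub_le_viscousPotential (hK : LipschitzWith K φ) (hε : 0 < ε) (hε' : ε ≤ 1)
    (ht : 0 < t) (x : EuclideanSpace ℝ (Fin d)) :
    hopfLax φ t x - ε * (K ^ 2 * t + d / 2 * Real.log (2 / ε)) ≤ viscousPotential φ ε t x := by
  have hcost : ∀ z, hopfLax φ t x / ε - K ^ 2 * t + (4 * t)⁻¹ * ‖z‖ ^ 2 ≤
      ‖z‖ ^ 2 / (2 * ε * t) + φ (x + z) / ε := fun z => by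
    have h := hopfLax_add_mul_le hK ht hε.le hε' x (x + z)
    rw [sub_add_cancel_left, norm_neg] at h
    refine le_of_mul_le_mul_left ?_ hε
    calc ε * (hopfLax φ t x / ε - K ^ 2 * t + (4 * t)⁻¹ * ‖z‖ ^ 2)
        = hopfLax φ t x + ε * (‖z‖ ^ 2 / (4 * t) - K ^ 2 * t) := by
          field_simp
          ring
      _ ≤ ‖z‖ ^ 2 / (2 * t) + φ (x + z) := h
      _ = ε * (‖z‖ ^ 2 / (2 * ε * t) + φ (x + z) / ε) := by field_simp
  have hlog := mul_le_mul_of_nonneg_left (log_partitionFunction_le (lipschitzWith_div_const hK hε)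
    (by positivity : 0 < 2 * ε * t) (by positivity : 0 < (4 * t)⁻¹) hcost) hε.le
  have hgauss : Real.log (Real.pi / (4 * t)⁻¹) =
      Real.log (2 * Real.pi * ε * t) + Real.log (2 / ε) := by
    rw [← Real.log_mul (by positivity) (by positivity)]
    congr 1
    field_simp
    ring
  have hcancel : ε * (hopfLax φ t x / ε) = hopfLax φ t x := mul_div_cancel₀ _ hε.ne'
  rw [hgauss, finrank_euclideanSpace_fin] at hlog
  rw [viscousPotential_eq hK hε ht]
  linarith

/-- A bound, nondecreasing in the time `t`, for the distance between the viscous potential and its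
limit. -/
noncomputable def viscosityError (d : ℕ) (K lam t ε : ℝ) : ℝ :=
  ε * (d / 2 * Real.log (1 + lam * t) + K ^ 2 * t + d / 2 * Real.log (2 / ε))

theorem viscosityError_mono (d : ℕ) (K : ℝ) (hlam : 0 ≤ lam) (hε : 0 ≤ ε) {s : ℝ} (hs : 0 ≤ s)
    (hst : s ≤ t) : viscosityError d K lam s ε ≤ viscosityError d K lam t ε := by
  have : 0 < 1 + lam * s := by positivity
  unfold viscosityError
  gcongr

theorem tendsto_viscosityError (d : ℕ) (K lam t : ℝ) :
    Tendsto (viscosityError d K lam t) (𝓝[>] 0) (𝓝 0) := by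
  have hid : Tendsto (fun ε : ℝ => ε) (𝓝[>] 0) (𝓝 0) := nhdsWithin_le_nhds
  have hlog : Tendsto (fun ε : ℝ => Real.log ε * ε) (𝓝[>] 0) (𝓝 0) := by
    simpa only [Real.rpow_one] using tendsto_log_mul_rpow_nhdsGT_zero one_pos
  have hsum := (hid.mul_const (d / 2 * Real.log (1 + lam * t) + K ^ 2 * t +
    d / 2 * Real.log 2)).sub (hlog.const_mul ((d : ℝ) / 2))
  rw [zero_mul, mul_zero, sub_zero] at hsum
  refine hsum.congr' ?_
  filter_upwards [self_mem_nhdsWithin] with ε (hε : 0 < ε)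
  rw [viscosityError, Real.log_div two_ne_zero hε.ne']
  ring

theorem abs_viscousPotential_sub_hopfLax_le (hK : LipschitzWith K φ) (hlam : 0 ≤ lam)
    (hconc : ConcaveOn ℝ univ fun y => φ y - lam / 2 * ‖y‖ ^ 2) (hε : 0 < ε) (hε' : ε ≤ 1)
    (ht : 0 < t) (x : EuclideanSpace ℝ (Fin d)) :
    |viscousPotential φ ε t x - hopfLax φ t x| ≤ viscosityError d K lam t ε := by
  have hupper := viscousPotential_le_hopfLax_add hK hlam hconc hε ht x
  have hlower := hopfLax_sub_le_viscousPotential hK hε hε' ht x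
  have hlog : 0 ≤ ε * (d / 2 * Real.log (1 + lam * t)) := by
    have := Real.log_nonneg (by nlinarith : 1 ≤ 1 + lam * t)
    positivity
  have hrest : 0 ≤ ε * (K ^ 2 * t + d / 2 * Real.log (2 / ε)) := by
    have := Real.log_nonneg ((one_le_div hε).2 (by linarith : ε ≤ 2))
    positivity
  rw [viscosityError, abs_le]
  constructor <;> linarith

theorem norm_viscousFlow_sub_sq_le (hK : LipschitzWith K φ) (hlam : 0 ≤ lam)
    (hconc : ConcaveOn ℝ univ fun y => φ y - lam / 2 * ‖y‖ ^ 2) (hε : ε ∈ Ioc 0 1)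
    (hδ : δ ∈ Ioc 0 1) (ht : 0 ≤ t)
    {X Y : EuclideanSpace ℝ (Fin d) → ℝ → EuclideanSpace ℝ (Fin d)} (hX : IsViscousFlow φ ε X)
    (hY : IsViscousFlow φ δ Y) (y : EuclideanSpace ℝ (Fin d)) :
    ‖X y t - Y y t‖ ^ 2 ≤ Real.exp (2 * lam * t) *
      (4 * (viscosityError d K lam t ε + viscosityError d K lam t δ) * t) := by
  rcases ht.eq_or_lt with rfl | ht0
  · simp [hX.initial, hY.initial]
  have herror {η : ℝ} (hη : η ∈ Ioc 0 1) {r : ℝ} (hr : r ∈ Ioc 0 t) (x) :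
      |viscousPotential φ η r x - hopfLax φ r x| ≤ viscosityError d K lam t η :=
    (abs_viscousPotential_sub_hopfLax_le hK hlam hconc hη.1 hη.2 hr.1 x).trans
      (viscosityError_mono d K hlam hη.1.le hr.1.le hr.2)
  have hnonneg {η : ℝ} (hη : η ∈ Ioc 0 1) : 0 ≤ viscosityError d K lam t η :=
    (abs_nonneg _).trans (herror hη ⟨ht0, le_rfl⟩ 0)
  have hclose (r : ℝ) (hr : r ∈ Ioo 0 t) (x) :
      |viscousPotential φ ε r x - viscousPotential φ δ r x| ≤
        viscosityError d K lam t ε + viscosityError d K lam t δ := by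
    refine (abs_sub_le _ (hopfLax φ r x) _).trans (add_le_add (herror hε ⟨hr.1, hr.2.le⟩ x) ?_)
    rw [abs_sub_comm]
    exact herror hδ ⟨hr.1, hr.2.le⟩ x
  have h := norm_sub_sq_le_of_inner_le ht hlam
    (mul_nonneg zero_le_two (add_nonneg (hnonneg hε) (hnonneg hδ)))
    ((hX.continuousOn y).mono Icc_subset_Ici_self) ((hY.continuousOn y).mono Icc_subset_Ici_self)
    (fun r hr => hX.hasDerivAt y r hr.1) (fun r hr => hY.hasDerivAt y r hr.1)
    (fun r hr => inner_gradient_viscousPotential_sub_le hK hconc hε.1 hδ.1 hr.1 (hclose r hr) _ _)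
  rw [hX.initial, hY.initial] at h
  refine h.trans_eq ?_
  rw [sub_self, norm_zero, sub_zero]
  ring

theorem exists_isLagrangianFlow (hK : LipschitzWith K φ) (hlam : 0 ≤ lam)
    (hconc : ConcaveOn ℝ univ fun y => φ y - lam / 2 * ‖y‖ ^ 2) :
    ∃ X, IsLagrangianFlow φ X := by
  choose! Xε hXε using fun ε (hε : 0 < ε) => exists_isViscousFlow hK hlam hconc hε
  suffices h : ∀ y t, 0 ≤ t → ∃ z, Tendsto (fun ε => Xε ε y t) (𝓝[>] 0) (𝓝 z) by
    choose! X hX using h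
    exact ⟨X, Xε, hXε, hX⟩
  intro y t ht
  refine cauchy_map_iff_exists_tendsto.1 (cauchy_map_iff.2 ⟨inferInstance, ?_⟩)
  rw [tendsto_uniformity_iff_dist_tendsto_zero]
  have hevent : ∀ᶠ ε : ℝ in 𝓝[>] 0, ε ∈ Ioc 0 1 := Ioc_mem_nhdsGT one_pos
  have herror := tendsto_viscosityError d K lam t
  have hbound : Tendsto (fun p : ℝ × ℝ => √(Real.exp (2 * lam * t) *
      (4 * (viscosityError d K lam t p.1 + viscosityError d K lam t p.2) * t)))
      (𝓝[>] 0 ×ˢ 𝓝[>] 0) (𝓝 0) := by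
    simpa using (((((herror.comp tendsto_fst).add (herror.comp tendsto_snd)).const_mul 4).mul_const
      t).const_mul (Real.exp (2 * lam * t))).sqrt
  refine squeeze_zero' (Eventually.of_forall fun _ => dist_nonneg) ?_ hbound
  filter_upwards [hevent.prod_mk hevent] with p ⟨hε, hδ⟩
  rw [dist_eq_norm]
  exact Real.le_sqrt_of_sq_le (norm_viscousFlow_sub_sq_le hK hlam hconc hε hδ ht
    (hXε p.1 hε.1) (hXε p.2 hδ.1) y)

theorem IsLagrangianFlow.lipschitzWith
    {X : EuclideanSpace ℝ (Fin d) → ℝ → EuclideanSpace ℝ (Fin d)} (hX : IsLagrangianFlow φ X)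
    (hK : LipschitzWith K φ) (hlam : 0 ≤ lam)
    (hconc : ConcaveOn ℝ univ fun y => φ y - lam / 2 * ‖y‖ ^ 2) (ht : 0 ≤ t) :
    LipschitzWith (Real.exp (lam * t)).toNNReal fun y => X y t := by
  obtain ⟨Xε, hXε, hlim⟩ := hX
  refine LipschitzWith.of_dist_le_mul fun y z => ?_
  refine le_of_tendsto ((hlim y t ht).dist (hlim z t ht)) ?_
  filter_upwards [self_mem_nhdsWithin] with ε hε
  exact ((hXε ε hε).lipschitzWith hK hlam hconc hε ht).dist_le_mul y z

end VanishingViscosity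

end Adhesion

theorem theorem3 {d : ℕ} (φ : EuclideanSpace ℝ (Fin d) → ℝ) (K : ℝ≥0) (lam : ℝ)
    (hK : LipschitzWith K φ) (hlam : 0 ≤ lam)
    (hconc : ConcaveOn ℝ Set.univ (fun y => φ y - lam / 2 * ‖y‖ ^ 2)) :
    (∃ X, Adhesion.IsLagrangianFlow φ X) ∧
    ∀ X, Adhesion.IsLagrangianFlow φ X → ∀ t : ℝ, 0 ≤ t →
      volume (Adhesion.singularImage X t) = 0 ∧
      Adhesion.IsLebesgueDecomposition (Adhesion.massMeasure X t) volume
        ((Adhesion.massMeasure X t).restrict (Adhesion.singularImage X t)ᶜ)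
        ((Adhesion.massMeasure X t).restrict (Adhesion.singularImage X t)) ∧
      volume.withDensity ((Adhesion.massMeasure X t).rnDeriv volume) =
        (Adhesion.massMeasure X t).restrict (Adhesion.singularImage X t)ᶜ ∧
      (Adhesion.massMeasure X t).singularPart volume =
        (Adhesion.massMeasure X t).restrict (Adhesion.singularImage X t) := by
  refine ⟨Adhesion.exists_isLagrangianFlow hK hlam hconc, fun X hX t ht => ?_⟩
  have hLip := hX.lipschitzWith hK hlam hconc ht
  have hdecomp :=
    Adhesion.isLebesgueDecomposition_map volume hLip.continuous hLip.ae_differentiableAt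
  have : SFinite (Adhesion.massMeasure X t) := by unfold Adhesion.massMeasure; infer_instance
  exact ⟨Adhesion.addHaar_image_criticalSet volume _, hdecomp, hdecomp.withDensity_rnDeriv_eq,
    hdecomp.singularPart_eq⟩
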